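/- Let $CP^1$ carry the Fubini--Study metric $g=\frac{|d\zeta|^2}{(1+|\zeta|^2)^2}$ ($\zeta$ the affine coordinate), its Kähler form $\omega$, with $g(X,Y)=\omega(X,JY)$, the Levi-Civita connection $\nabla$ and its unique metaplectic structure. Let $\mathbf Q$ be the bundle of symplectic spinors, with fibre $L^2(\mathbb R)$. In a local unitary frame $(e,f)$, $f=Je$, $\omega(e,f)=1$, symplectic Clifford multiplication by $e$ and by $f$ is $ix$ and $\frac{d}{dx}$. Put $$\mathcal D\varphi=e\cdot\nabla_f\varphi-f\cdot\nabla_e\varphi,\qquad \widetilde{\mathcal D}\varphi=e\cdot\nabla_e\varphi+f\cdot\nabla_f\varphi,\qquad \mathcal P=i[\widetilde{\mathcal D},\mathcal D].$$ For $l=0,1,2,\dots$ let $\mathbf Q_l\subset\mathbf Q$ be the line subbundle spanned by the $l$-th Hermite function, on which $\frac12(e\cdot e+f\cdot f)$ equals $q_l=-(l+\frac12)$. Then $\mathcal P$ maps $\Gamma(\mathbf Q_l)$ into itself. Let $\mathcal P_l$ be its restriction to $\Gamma(\mathbf Q_l)$, and put $m=l+1$. The eigenvalues of $\mathcal P_l$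 are exactly $$\lambda_{l,j}=4(l+j+1)^2-3(2l+1)^2-1,\qquad j=0,1,2,\dots,$$ and $\lambda_{l,j}$ has multiplicity $2(l+j+1)$. The heat semigroup $e^{-t\mathcal P_l}$ on the $L^2$ sections of $\mathbf Q_l$ exists, and for every $t>0$ its trace $K(\mathcal P_l,t)=\operatorname{Tr}e^{-t\mathcal P_l}$ exists and equals $\sum_{j\ge0}2(l+j+1)e^{-t\lambda_{l,j}}$. As $t\to+0$, $$K(\mathcal P_l,t)=\frac1{4t}+\Bigl(\frac56-2m+2m^2\Bigr)+t\Bigl(\frac{19}{15}-6m+14m^2-16m^3+8m^4\Bigr)+O(t^2).$$ Moreover, with $\rho$ the scalar curvature of $g$, these coefficients agree with the general formulas for the heat kernel coefficients in two dimensions: $$\frac14=\frac{\operatorname{vol}(CP^1)}{4\pi},\qquad \frac56-2m+2m^2=\frac{1+6q_l^2}{4\pi\cdot 6}\int_{CP^1}\rho,$$ $$\frac{19}{15}-6m+14m^2-16m^3+8m^4=\frac{2+15q_l^2+60q_l^4}{4\pi\cdot120}\int_{CP^1}\rho^2 .$$ -/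

import Mathlib

open Filter Topology MeasureTheory Metric Asymptotics
open scoped Manifold ContDiff

noncomputable section

namespace SymplecticSpinor

/-! ### Complex projective line and its metaplectic frame bundle

`CP¹` with the Fubini-Study metric is the base of the Hopf fibration `S³ → CP¹`, the metric being the
one that makes this map a Riemannian submersion from the unit sphere of `ℂ²`.
A point `g = (z, w)` of `S³` determines the horizontal unit vector `v(g) = (-w̄, z̄)`, and
`e = dπ (v(g))`, `f = dπ (i v(g)) = J e` is a unitary frame of `T CP¹` at `π(g)`, `ω(e, f) = 1`.
Since `v(e^{iθ} g) = e^{-iθ} v(g)`, the frame at `e^{iθ} g` is the frame at `g` rotated by `-2θ`. So `S³`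
is the double cover of the bundle of unitary frames, that is, the (unique) metaplectic structure
of `CP¹` reduced to the double cover of `U(1)`. The horizontal distribution (the complex lines
spanned by `v(g)`) is the lift of the Levi-Civita connection. -/

/-- `ℂ²` with its Hermitian norm. -/
abbrev C2 : Type := EuclideanSpace ℂ (Fin 2)

/-- The unit sphere of `ℂ²`. -/
abbrev S3 : Type := sphere (0 : C2) 1

instance factFinrankC2 : Fact (Module.finrank ℝ C2 = 3 + 1) :=
  ⟨by rw [← Module.finrank_mul_finrank ℝ ℂ C2]; simp⟩

/-- The horizontal vector `v(g) = (-w̄, z̄)` at `g = (z, w)`. -/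
def perp (g : C2) : C2 := !₂[-(starRingEnd ℂ) (g 1), (starRingEnd ℂ) (g 0)]

theorem curve_mem (c : Circle) (g : S3) (t : ℝ) :
    (Real.cos t : ℂ) • (g : C2) + ((Real.sin t : ℂ) * c) • perp g ∈ sphere (0 : C2) 1 := by
  have hg : ‖(g : C2)‖ ^ 2 = 1 := by
    have := g.2
    rw [mem_sphere_iff_norm, sub_zero] at this
    rw [this, one_pow]
  have hc : Complex.normSq (c : ℂ) = 1 := Circle.normSq_coe c
  rw [mem_sphere_iff_norm, sub_zero, ← sq_eq_sq₀ (norm_nonneg _) zero_le_one, one_pow]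
  rw [EuclideanSpace.norm_sq_eq, Fin.sum_univ_two, ← Complex.normSq_eq_norm_sq,
    ← Complex.normSq_eq_norm_sq] at hg ⊢
  simp only [perp, PiLp.add_apply, PiLp.smul_apply, smul_eq_mul, Complex.normSq_apply,
    Complex.add_re, Complex.add_im, Complex.mul_re, Complex.mul_im, Complex.ofReal_re,
    Complex.ofReal_im, Matrix.cons_val_zero, Matrix.cons_val_one,
    Complex.neg_re, Complex.neg_im, Complex.conj_re, Complex.conj_im] at hg hc ⊢
  have ht := Real.sin_sq_add_cos_sq t
  linear_combination (Real.cos t ^ 2 + Real.sin t ^ 2 *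
      ((c : ℂ).re * (c : ℂ).re + (c : ℂ).im * (c : ℂ).im)) * hg
    + Real.sin t ^ 2 * hc + ht

/-- The horizontal great circle `t ↦ cos t • g + sin t • (c v(g))` through `g`. Its velocity at `0` is the
horizontal lift of `e` for `c = 1`, and of `f = J e` for `c = i`. -/
def curve (c : Circle) (g : S3) (t : ℝ) : S3 :=
  ⟨(Real.cos t : ℂ) • (g : C2) + ((Real.sin t : ℂ) * c) • perp g, curve_mem c g t⟩

theorem rot_mem (θ : ℝ) (g : S3) :
    Complex.exp (θ * Complex.I) • (g : C2) ∈ sphere (0 : C2) 1 := by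
  have := g.2
  simp only [mem_sphere_iff_norm, sub_zero] at this ⊢
  rw [norm_smul, this, Complex.norm_exp_ofReal_mul_I, one_mul]

/-- The action `g ↦ e^{iθ} g` of the structure group on the frame bundle. -/
def rot (θ : ℝ) (g : S3) : S3 := ⟨Complex.exp (θ * Complex.I) • (g : C2), rot_mem θ g⟩

/-- The imaginary unit as a point of the unit circle. -/
def circleI : Circle := ⟨Complex.I, by simp [Submonoid.unitSphere]⟩

/-! ### Symplectic spinor fields, Dirac operators and the Laplacian -/

/-- Symplectic spinor fields on `CP¹`, written as functions on the frame bundle with values in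
functions on the real line. -/
abbrev SpinorField : Type := S3 → ℝ → ℂ

/-- Symplectic Clifford multiplication by `e`: multiplication by `i x`. -/
def cliffE (Φ : SpinorField) : SpinorField := fun g x => Complex.I * x * Φ g x

/-- Symplectic Clifford multiplication by `f`: differentiation in `x`. -/
def cliffF (Φ : SpinorField) : SpinorField := fun g x => deriv (Φ g) x

/-- The covariant derivative `∇_e`: the derivative along the horizontal lift of `e`. -/
def nablaE (Φ : SpinorField) : SpinorField := fun g x => deriv (fun t => Φ (curve 1 g t) x) 0

/-- The covariant derivative `∇_f`: the derivative along the horizontal lift of `f`. -/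
def nablaF (Φ : SpinorField) : SpinorField := fun g x => deriv (fun t => Φ (curve circleI g t) x) 0

/-- The symplectic Dirac operator `D = e · ∇_f - f · ∇_e`. -/
def dirac (Φ : SpinorField) : SpinorField := cliffE (nablaF Φ) - cliffF (nablaE Φ)

/-- The second symplectic Dirac operator `D̃ = e · ∇_e + f · ∇_f`. -/
def diracTilde (Φ : SpinorField) : SpinorField := cliffE (nablaE Φ) + cliffF (nablaF Φ)

/-- The Laplacian `P = i [D̃, D]`. -/
def laplacianP (Φ : SpinorField) : SpinorField :=
  Complex.I • (diracTilde (dirac Φ) - dirac (diracTilde Φ))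

/-! ### The line bundles `Q_l` -/

/-- The value `q_l = -(l + 1/2)` of the operator `(e·e + f·f)/2` on the `l`-th Hermite function. -/
def charge (l : ℕ) : ℝ := -(l + 1 / 2)

/-- The Hermite function `h_l`, of norm one in `L²(ℝ)`. -/
def hermiteFun (l : ℕ) (x : ℝ) : ℝ :=
  (Polynomial.aeval (√2 * x) (Polynomial.hermite l) : ℝ) * Real.exp (-x ^ 2 / 2) /
    √(√Real.pi * (l.factorial : ℝ))

/-- Smooth sections of the line bundle `Q_l`, given by their coefficient `u` with respect to `h_l`:
the section is `g ↦ u(g) h_l`. The lift to the double cover of the rotation by `-2θ` acts in the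
metaplectic representation as `exp (2 i θ H)`, `H = (e·e + f·f)/2`, hence on `h_l` as `exp (2 i θ q_l)`;
a section is equivariant with respect to the inverse of this. -/
def sections (l : ℕ) : Submodule ℂ (S3 → ℂ) where
  carrier := {u | ContMDiff (𝓡 3) 𝓘(ℝ, ℂ) ∞ u ∧
    ∀ (θ : ℝ) (g : S3), u (rot θ g) = Complex.exp (-(2 * θ * charge l) * Complex.I) * u g}
  add_mem' := by
    rintro u v ⟨hu, hu'⟩ ⟨hv, hv'⟩
    refine ⟨hu.add hv, fun θ g => ?_⟩
    simp only [Pi.add_apply, hu', hv']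
    ring
  zero_mem' := ⟨contMDiff_const, fun θ g => by simp⟩
  smul_mem' := by
    rintro c u ⟨hu, hu'⟩
    refine ⟨(contDiff_const (c := c).mul contDiff_id).contMDiff.comp hu, fun θ g => ?_⟩
    simp only [Pi.smul_apply, smul_eq_mul, hu']
    ring

/-- The symplectic spinor field `g ↦ u(g) h_l`. -/
def toSpinor (l : ℕ) (u : S3 → ℂ) : SpinorField := fun g x => u g * hermiteFun l x

/-- `A` is the restriction `P_l` of the Laplacian to the sections of `Q_l`. As `h_l ≠ 0`, there is at
most one such `A`. -/
def IsRestriction (l : ℕ) (A : Module.End ℂ (sections l)) : Prop :=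
  ∀ u : sections l, toSpinor l (A u : S3 → ℂ) = laplacianP (toSpinor l (u : S3 → ℂ))

/-- The measure on `S³` which gives the integral over `CP¹` of functions that are constant on the
Hopf circles: these circles have length `2π`. -/
def hopfMeasure : Measure S3 :=
  Real.toNNReal (1 / (2 * Real.pi)) • (volume : Measure C2).toSphere

instance isFiniteMeasure_hopfMeasure : IsFiniteMeasure hopfMeasure := by
  unfold hopfMeasure; infer_instance

/-- The `L²` class of a smooth section of `Q_l`. -/
def toL2 (l : ℕ) : sections l →ₗ[ℂ] Lp ℂ 2 hopfMeasure where
  toFun u := ContinuousMap.toLp 2 hopfMeasure ℂ ⟨u, u.2.1.continuous⟩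
  map_add' u v := by rw [← map_add]; rfl
  map_smul' c u := by rw [RingHom.id_apply, ← map_smul]; rfl

/-- The Hilbert space of square integrable sections of `Q_l`: the completion of the smooth
sections in the `L²` norm. -/
abbrev L2Sections (l : ℕ) : Submodule ℂ (Lp ℂ 2 hopfMeasure) :=
  (LinearMap.range (toL2 l)).topologicalClosure

/-- The inclusion of smooth sections into square integrable sections. -/
def incl (l : ℕ) : sections l →ₗ[ℂ] L2Sections l :=
  (toL2 l).codRestrict (L2Sections l) fun u =>
    Submodule.le_topologicalClosure _ (LinearMap.mem_range_self _ u)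

/-! ### Heat semigroups and traces -/

/-- `S t = exp (-t A)` for `t ≥ 0`: a strongly continuous one-parameter semigroup of bounded
operators on `H` whose generator extends `-A`, where `A` acts on the space `V` of smooth vectors. -/
structure IsHeatSemigroup {V H : Type*} [AddCommGroup V] [Module ℂ V] [NormedAddCommGroup H]
    [InnerProductSpace ℂ H] (i : V →ₗ[ℂ] H) (A : Module.End ℂ V) (S : ℝ → H →L[ℂ] H) : Prop where
  zero : S 0 = 1
  add : ∀ s t : ℝ, 0 ≤ s → 0 ≤ t → S (s + t) = S s * S t
  cont : ∀ x : H, ContinuousOn (fun t => S t x) (Set.Ici 0)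
  deriv : ∀ v : V, HasDerivWithinAt (fun t => S t (i v)) (-i (A v)) (Set.Ici 0) 0

/-- The bounded operator `T` has trace `c`, computed in any orthonormal basis. -/
def HasTrace {H : Type} [NormedAddCommGroup H] [InnerProductSpace ℂ H] (T : H →L[ℂ] H) (c : ℂ) :
    Prop :=
  ∀ (ι : Type) (b : HilbertBasis ι ℂ H), HasSum (fun k => inner ℂ (b k) (T (b k))) c

/-! ### Volume and curvature of `CP¹` in the affine chart `ζ = w / z` -/

/-- The Fubini-Study metric in the affine chart is `exp (2 φ) |dζ|²` with `φ = -log (1 + |ζ|²)`. The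
complement of the chart is one point. -/
def fsPotential (ζ : ℂ) : ℝ := -Real.log (1 + ‖ζ‖ ^ 2)

/-- The Riemannian area `exp (2 φ) dx dy`. -/
def fsArea : Measure ℂ :=
  (volume : Measure ℂ).withDensity fun ζ => ENNReal.ofReal (Real.exp (2 * fsPotential ζ))

/-- The scalar curvature `ρ = -2 exp (-2 φ) Δ φ` of the metric `exp (2 φ) |dζ|²` (twice its Gaussian
curvature). -/
def fsScalarCurvature (ζ : ℂ) : ℝ :=
  -2 * Real.exp (-2 * fsPotential ζ) * Laplacian.laplacian fsPotential ζ

/-! ### The numbers in the claim -/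

/-- The eigenvalues `λ_{l,j}`. -/
def eigval (l j : ℕ) : ℝ := 4 * ((l : ℝ) + j + 1) ^ 2 - 3 * (2 * (l : ℝ) + 1) ^ 2 - 1

/-- Their multiplicities. -/
def mult (l j : ℕ) : ℕ := 2 * (l + j + 1)

end SymplecticSpinor

end

noncomputable section

namespace SymplecticSpinor

/-! ### Smooth functions on the sphere -/

/-! The sections of `Q_l` are the smooth functions on `S³` of weight `2l+1` along the Hopf fibres,
so the spectral problem becomes one about the `sl₂` relations on `S³`. The operators `(∇_e ∓
i∇_f)/2`, `lowering` and `raising`, shift the weight by `∓2`. On weight `w` their commutator is `w`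
(`lowering_raising_sub`), because the bracket of the two horizontal fields points along the fibre.
On a product `u ⊗ h_l` the operator `i[D̃, D]` reduces to `i(e·e + f·f)[∇_e, ∇_f] - ∇_e² - ∇_f²`
(`laplacianP_tensor`), and the Hermite equation turns this into `-4l(2l+1) - 4·lowering∘raising`.

The monomials `z^a w^b` are killed by `raising`. Lowering one of them `j` times gives an eigenvector
of `lowering∘raising` with eigenvalue `-j(a+b-j+1)`. The result has weight `2l+1` exactly when `a+b
= 2l+1+2j`, which leaves `2(l+j+1)` choices of `a` and yields `λ_{l,j}`. Orthogonality comes from a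
torus action and from the symmetry of the operator. For completeness, the span of all ladders is
stable under multiplication by the coordinates and their conjugates, so Stone-Weierstrass makes it
dense (`dense_map_multipliers`, `eq_zero_of_inner_ladder`). Ladders of other weights are orthogonal
to the sections of `Q_l`, so the remaining ones form the Hilbert basis `eigenbasis`.

In this basis the heat semigroup is diagonal. Any heat semigroup acts on an eigenvector by `e^{-tλ}`
(`IsHeatSemigroup.apply_eigenvector`), and since these factors are positive the trace is the same in
every orthonormal basis (`hasTrace_of_hasSum`).

The expansion needs `∑ n e^{-sn²}` up to `O(s²)`. Completing squares makes `∑ e^{-sn²} sinh(Nsn)`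
telescope to a closed form (`hasSum_exp_mul_sinh`). A combination of `N = 1, 2, 3` replaces `sinh`
by its argument up to order seven, and the error, after multiplication by `s`, is `O(s³)`
(`exists_abs_tsum_mul_exp_sub_le`). The trace is such a sum with `s = 4t`, minus its first `l+1`
terms, times an exponential. The coefficient formulas follow from area `π` and constant scalar
curvature `8`. -/

/-- The radial projection of a nonzero vector to the unit sphere. -/
def radial (x : C2) (hx : x ≠ 0) : S3 :=
  ⟨(‖x‖⁻¹ : ℝ) • x, by
    rw [mem_sphere_iff_norm, sub_zero, norm_smul, norm_inv, norm_norm,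
      inv_mul_cancel₀ (norm_ne_zero_iff.2 hx)]⟩

theorem norm_coe_sphere (g : S3) : ‖(g : C2)‖ = 1 := by
  simp

theorem coe_sphere_ne_zero (g : S3) : (g : C2) ≠ 0 := by
  intro h
  simpa [h] using norm_coe_sphere g

theorem radial_coe (g : S3) : radial g (coe_sphere_ne_zero g) = g := by
  apply Subtype.ext
  simp [radial, norm_coe_sphere g]

open Classical in
/-- The extension of a function on the sphere to the whole space, constant along rays where
`2 ‖x‖ ^ 2 ≥ 1` and vanishing near the origin. -/
def cutoffExt (u : S3 → ℂ) (x : C2) : ℂ :=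
  if hx : x ≠ 0 then (Real.smoothTransition (4 * ‖x‖ ^ 2 - 1) : ℂ) * u (radial x hx) else 0

theorem cutoffExt_coe (u : S3 → ℂ) (g : S3) : cutoffExt u g = u g := by
  rw [cutoffExt, dif_pos (coe_sphere_ne_zero g), radial_coe, norm_coe_sphere,
    Real.smoothTransition.one_of_one_le (by norm_num)]
  simp

/-- The cutoff removes the singularity of the radial projection at the origin. Hence every smooth
function on the sphere is the restriction of a smooth function on `ℂ²`, and derivatives along
horizontal circles become ambient Fréchet derivatives. -/
theorem contDiff_cutoffExt {u : S3 → ℂ} (hu : ContMDiff (𝓡 3) 𝓘(ℝ, ℂ) ∞ u) :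
    ContDiff ℝ ∞ (cutoffExt u) := by
  classical
  rw [contDiff_iff_contDiffAt]
  intro x
  by_cases hx : x = 0
  · have : cutoffExt u =ᶠ[𝓝 x] fun _ => 0 := by
      subst hx
      filter_upwards [ball_mem_nhds (0 : C2) (show (0 : ℝ) < 1 / 2 by norm_num)] with y hy
      rw [cutoffExt]
      split_ifs with h
      · rw [Real.smoothTransition.zero_of_nonpos]
        · simp
        · rw [mem_ball_zero_iff] at hy
          nlinarith [norm_nonneg y]
      · rfl
    exact contDiffAt_const.congr_of_eventuallyEq this
  · let U : TopologicalSpace.Opens C2 := ⟨{0}ᶜ, isOpen_compl_singleton⟩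
    have hf : ContMDiff 𝓘(ℝ, C2) 𝓘(ℝ, C2) ∞ (fun y : U => (‖(y : C2)‖⁻¹ : ℝ) • (y : C2)) := by
      intro y
      have hy : (y : C2) ≠ 0 := y.2
      refine (contMDiffAt_subtype_iff (U := U) (f := fun y : C2 => (‖y‖⁻¹ : ℝ) • y)).2 ?_
      exact (((contDiffAt_norm ℝ hy).inv (norm_ne_zero_iff.2 hy)).smul contDiffAt_id).contMDiffAt
    have hv := hu.comp (hf.codRestrict_sphere fun y : U => (radial y y.2).2)
    let w : C2 → ℂ := fun y => if hy : y ≠ 0 then u (radial y hy) else 0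
    have hw : ContDiffAt ℝ ∞ w x := by
      rw [← contMDiffAt_iff_contDiffAt]
      refine (contMDiffAt_subtype_iff (U := U) (f := w) (x := ⟨x, hx⟩)).1 ?_
      convert hv.contMDiffAt using 1
      ext y
      have hy : (y : C2) ≠ 0 := y.2
      simp only [w, dif_pos hy]
      rfl
    have hc : ContDiffAt ℝ ∞ (fun y : C2 => (Real.smoothTransition (4 * ‖y‖ ^ 2 - 1) : ℂ)) x := by
      refine Complex.ofRealCLM.contDiff.contDiffAt.comp x ?_
      refine (Real.smoothTransition.contDiff (n := ⊤)).contDiffAt.comp x ?_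
      exact ((contDiff_const.mul (contDiff_norm_sq ℝ)).sub contDiff_const).contDiffAt
    refine (hc.mul hw).congr_of_eventuallyEq (Eventually.of_forall fun y => ?_)
    simp only [cutoffExt, w]
    split_ifs <;> simp

theorem contMDiff_restrict {G : C2 → ℂ} (hG : ContDiff ℝ ∞ G) :
    ContMDiff (𝓡 3) 𝓘(ℝ, ℂ) ∞ (fun g : S3 => G g) :=
  hG.contMDiff.comp contMDiff_coe_sphere

/-- The algebra of smooth complex functions on the sphere. -/
def Smooth : Subalgebra ℂ (S3 → ℂ) where
  carrier := {u | ContMDiff (𝓡 3) 𝓘(ℝ, ℂ) ∞ u}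
  add_mem' := fun hu hv => hu.add hv
  mul_mem' := fun {u v} hu hv => by
    have := contMDiff_restrict ((contDiff_cutoffExt hu).mul (contDiff_cutoffExt hv))
    have h : u * v = fun g : S3 => cutoffExt u g * cutoffExt v g := by
      ext g
      simp [cutoffExt_coe]
    rw [h]
    exact this
  algebraMap_mem' := fun _ => contMDiff_const

/-- The restriction of a smooth function on `ℂ²` to the sphere. -/
def Smooth.restrict (G : C2 → ℂ) (hG : ContDiff ℝ ∞ G) : Smooth :=
  ⟨fun g => G g, contMDiff_restrict hG⟩

theorem Smooth.exists_ext (u : Smooth) :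
    ∃ (G : C2 → ℂ) (hG : ContDiff ℝ ∞ G), u = Smooth.restrict G hG :=
  ⟨cutoffExt u, contDiff_cutoffExt u.2, Subtype.ext (funext fun g => (cutoffExt_coe u.1 g).symm)⟩

/-! ### Derivatives along horizontal great circles -/

/-- The real-linear map `g ↦ c v(g)`. -/
def perpCLM (c : ℂ) : C2 →L[ℝ] C2 :=
  LinearMap.toContinuousLinearMap
    { toFun := fun g => c • perp g
      map_add' := fun x y => by
        ext i
        fin_cases i <;> simp [perp] <;> ring
      map_smul' := fun r x => by
        ext i
        fin_cases i <;> simp [perp] <;> ring }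

@[simp]
theorem perpCLM_apply (c : ℂ) (g : C2) : perpCLM c g = c • perp g := rfl

theorem perp_perp (g : C2) : perp (perp g) = -g := by
  ext i
  fin_cases i <;> simp [perp]

theorem perp_smul (c : ℂ) (g : C2) : perp (c • g) = (starRingEnd ℂ) c • perp g := by
  ext i
  fin_cases i <;> simp [perp]

theorem perp_add (x y : C2) : perp (x + y) = perp x + perp y := by
  simpa using (perpCLM 1).map_add x y

/-- Since `perp` is antilinear with square `-1` and `|c| = 1`, the great circle is an integral curve
of the field `c • perp` at every time, not only at `0`. Integration by parts relies on this. -/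
theorem hasDerivAt_curve (c : Circle) (g : S3) (t : ℝ) :
    HasDerivAt (fun s => (curve c g s : C2)) ((c : ℂ) • perp (curve c g t)) t := by
  have h1 : HasDerivAt (fun s : ℝ => (Real.cos s : ℂ)) ((-Real.sin t : ℝ) : ℂ) t :=
    (Real.hasDerivAt_cos t).ofReal_comp
  have h2 : HasDerivAt (fun s : ℝ => (Real.sin s : ℂ)) ((Real.cos t : ℝ) : ℂ) t :=
    (Real.hasDerivAt_sin t).ofReal_comp
  have h := (h1.smul_const (g : C2)).add ((h2.mul_const (c : ℂ)).smul_const (perp g))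
  refine h.congr_deriv ?_
  have hc : (c : ℂ) * (starRingEnd ℂ) (c : ℂ) = 1 := by
    rw [Complex.mul_conj, Circle.normSq_coe]; simp
  simp only [curve]
  rw [perp_add, perp_smul, perp_smul, perp_perp, smul_add, smul_smul, smul_smul, smul_neg,
    map_mul, Complex.conj_ofReal, Complex.conj_ofReal]
  rw [show (c : ℂ) * (↑(Real.sin t) * (starRingEnd ℂ) (c : ℂ)) = Real.sin t by
    rw [mul_left_comm, hc, mul_one]]
  rw [mul_comm (c : ℂ), add_comm]
  simp [neg_smul]

theorem curve_zero (c : Circle) (g : S3) : curve c g 0 = g := by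
  apply Subtype.ext
  simp [curve]

theorem hasDerivAt_comp_curve {G : C2 → ℂ} (hG : ContDiff ℝ ∞ G) (c : Circle) (g : S3) (t : ℝ) :
    HasDerivAt (fun s => G (curve c g s))
      (fderiv ℝ G (curve c g t) ((c : ℂ) • perp (curve c g t))) t :=
  ((hG.differentiable (by simp)) _).hasFDerivAt.comp_hasDerivAt t (hasDerivAt_curve c g t)

theorem contDiff_fderiv_perp {G : C2 → ℂ} (hG : ContDiff ℝ ∞ G) (c : ℂ) :
    ContDiff ℝ ∞ fun x => fderiv ℝ G x (c • perp x) :=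
  (hG.fderiv_right (m := ∞) (by simp)).clm_apply (perpCLM c).contDiff

/-- The derivative of a function on the sphere along the circles `curve c`. -/
def dcurve (c : Circle) (u : S3 → ℂ) (g : S3) : ℂ := deriv (fun t => u (curve c g t)) 0

theorem dcurve_restrict {G : C2 → ℂ} (hG : ContDiff ℝ ∞ G) (c : Circle) (g : S3) :
    dcurve c (fun g => G g) g = fderiv ℝ G g ((c : ℂ) • perp g) := by
  have := (hasDerivAt_comp_curve hG c g 0).deriv
  rwa [curve_zero] at this

/-- The derivation of the algebra of smooth functions defined by the circles `curve c`. -/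
def dcurveLM (c : Circle) : Smooth →ₗ[ℂ] Smooth where
  toFun u := ⟨dcurve c u, by
    obtain ⟨G, hG, rfl⟩ := Smooth.exists_ext u
    have := contMDiff_restrict (contDiff_fderiv_perp hG c)
    rwa [← funext (dcurve_restrict hG c)] at this⟩
  map_add' u v := by
    obtain ⟨G, hG, rfl⟩ := Smooth.exists_ext u
    obtain ⟨H, hH, rfl⟩ := Smooth.exists_ext v
    ext g
    exact deriv_add (hasDerivAt_comp_curve hG c g 0).differentiableAt
      (hasDerivAt_comp_curve hH c g 0).differentiableAt
  map_smul' a u := by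
    ext g
    exact deriv_const_mul_field a

theorem dcurveLM_restrict {G : C2 → ℂ} (hG : ContDiff ℝ ∞ G) (c : Circle) :
    dcurveLM c (Smooth.restrict G hG) =
      Smooth.restrict (fun x => fderiv ℝ G x ((c : ℂ) • perp x)) (contDiff_fderiv_perp hG c) :=
  Subtype.ext (funext fun g => dcurve_restrict hG c g)

theorem dcurveLM_mul (c : Circle) (u v : Smooth) :
    dcurveLM c (u * v) = dcurveLM c u * v + u * dcurveLM c v := by
  obtain ⟨G, hG, rfl⟩ := Smooth.exists_ext u
  obtain ⟨H, hH, rfl⟩ := Smooth.exists_ext v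
  ext g
  have := ((hasDerivAt_comp_curve hG c g 0).mul (hasDerivAt_comp_curve hH c g 0)).deriv
  rw [curve_zero] at this
  refine Eq.trans this ?_
  rw [dcurveLM_restrict, dcurveLM_restrict]
  rfl

/-! ### Weights, lowering and raising operators -/

/-- Functions of weight `w` for the action of the circle on the Hopf fibres. -/
def weight (w : ℤ) : Submodule ℂ Smooth where
  carrier := {u | ∀ (θ : ℝ) (g : S3), u.1 (rot θ g) = Complex.exp (w * θ * Complex.I) * u.1 g}
  add_mem' := by
    intro u v hu hv θ g
    change u.1 _ + v.1 _ = _ * (u.1 _ + v.1 _)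
    rw [hu, hv]
    ring
  zero_mem' := fun θ g => (mul_zero _).symm
  smul_mem' := by
    intro c u hu θ g
    change c * u.1 _ = _ * (c * u.1 _)
    rw [hu]
    ring

theorem dcurveLM_eq_re_add_im (c : Circle) (u : Smooth) :
    dcurveLM c u = (((c : ℂ).re : ℝ) : ℂ) • dcurveLM 1 u
      + (((c : ℂ).im : ℝ) : ℂ) • dcurveLM circleI u := by
  obtain ⟨G, hG, rfl⟩ := Smooth.exists_ext u
  rw [dcurveLM_restrict, dcurveLM_restrict, dcurveLM_restrict]
  ext g
  change fderiv ℝ G g ((c : ℂ) • perp g) =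
    (((c : ℂ).re : ℝ) : ℂ) * fderiv ℝ G g (((1 : Circle) : ℂ) • perp g)
      + (((c : ℂ).im : ℝ) : ℂ) * fderiv ℝ G g ((circleI : ℂ) • perp g)
  have : (c : ℂ) • perp g = (c : ℂ).re • (((1 : Circle) : ℂ) • perp (g : C2))
      + (c : ℂ).im • ((circleI : ℂ) • perp (g : C2)) := by
    rw [← Complex.coe_smul, ← Complex.coe_smul, smul_smul, smul_smul, ← add_smul]
    congr 1
    simp [circleI, Complex.re_add_im]
  rw [this, map_add, (fderiv ℝ G g).map_smul (c : ℂ).re, (fderiv ℝ G g).map_smul (c : ℂ).im,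
    Complex.real_smul, Complex.real_smul]

/-- Antilinearity of `perp` produces `e^{-iθ} = e^{iθ} e^{-2iθ}`: moving along the fibre by `θ`
turns the frame by `-2θ`. This is the source of the weight shift by `2`. -/
theorem curve_rot (c : Circle) (θ : ℝ) (g : S3) (t : ℝ) :
    curve c (rot θ g) t = rot θ (curve (c * Circle.exp (-2 * θ)) g t) := by
  apply Subtype.ext
  simp only [curve, rot, perp_smul, Circle.coe_mul, Circle.coe_exp, smul_add, smul_smul]
  congr 2
  · ring
  · rw [← Complex.exp_conj, map_mul, Complex.conj_I, Complex.conj_ofReal]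
    have : Complex.exp (θ * -Complex.I) = Complex.exp (θ * Complex.I)
        * Complex.exp (((-2 * θ : ℝ) : ℂ) * Complex.I) := by
      rw [← Complex.exp_add]
      congr 1
      push_cast
      ring
    rw [this]
    ring

theorem dcurveLM_rot {w : ℤ} {u : Smooth} (hu : u ∈ weight w) (c : Circle) (θ : ℝ) (g : S3) :
    (dcurveLM c u).1 (rot θ g) =
      Complex.exp (w * θ * Complex.I) * (dcurveLM (c * Circle.exp (-2 * θ)) u).1 g := by
  have h : (fun t => u.1 (curve c (rot θ g) t)) = fun t => Complex.exp (w * θ * Complex.I)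
      * u.1 (curve (c * Circle.exp (-2 * θ)) g t) := by
    ext t
    rw [curve_rot, hu]
  change deriv (fun t => u.1 (curve c (rot θ g) t)) 0 = _
  rw [h]
  exact deriv_const_mul_field _

/-- The operator `(∇_e - i ∇_f) / 2`, which lowers weights by `2`. -/
def lowering : Module.End ℂ Smooth :=
  (1 / 2 : ℂ) • (dcurveLM 1 - Complex.I • dcurveLM circleI)

/-- The operator `(∇_e + i ∇_f) / 2`, which raises weights by `2`. -/
def raising : Module.End ℂ Smooth :=
  (1 / 2 : ℂ) • (dcurveLM 1 + Complex.I • dcurveLM circleI)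

theorem lowering_apply (u : Smooth) :
    lowering u = (1 / 2 : ℂ) • (dcurveLM 1 u - Complex.I • dcurveLM circleI u) := rfl

theorem raising_apply (u : Smooth) :
    raising u = (1 / 2 : ℂ) • (dcurveLM 1 u + Complex.I • dcurveLM circleI u) := rfl

theorem dcurveLM_one_rot {w : ℤ} {u : Smooth} (hu : u ∈ weight w) (θ : ℝ) (g : S3) :
    (dcurveLM 1 u).1 (rot θ g) = Complex.exp (w * θ * Complex.I) *
      (Complex.cos (2 * θ) * (dcurveLM 1 u).1 g
        - Complex.sin (2 * θ) * (dcurveLM circleI u).1 g) := by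
  rw [dcurveLM_rot hu, dcurveLM_eq_re_add_im]
  change _ * (_ * (dcurveLM 1 u).1 g + _ * (dcurveLM circleI u).1 g) = _
  have h1 : (((1 * Circle.exp (-2 * θ) : Circle) : ℂ).re : ℂ) = Complex.cos (2 * θ) := by
    rw [one_mul, Circle.coe_exp, Complex.exp_ofReal_mul_I_re]
    simp
  have h2 : (((1 * Circle.exp (-2 * θ) : Circle) : ℂ).im : ℂ) = -Complex.sin (2 * θ) := by
    rw [one_mul, Circle.coe_exp, Complex.exp_ofReal_mul_I_im]
    simp
  rw [h1, h2]
  ring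

theorem dcurveLM_circleI_rot {w : ℤ} {u : Smooth} (hu : u ∈ weight w) (θ : ℝ) (g : S3) :
    (dcurveLM circleI u).1 (rot θ g) = Complex.exp (w * θ * Complex.I) *
      (Complex.sin (2 * θ) * (dcurveLM 1 u).1 g
        + Complex.cos (2 * θ) * (dcurveLM circleI u).1 g) := by
  rw [dcurveLM_rot hu, dcurveLM_eq_re_add_im]
  change _ * (_ * (dcurveLM 1 u).1 g + _ * (dcurveLM circleI u).1 g) = _
  have h0 : ((circleI * Circle.exp (-2 * θ) : Circle) : ℂ) =
      Complex.I * Complex.exp (((-2 * θ : ℝ) : ℂ) * Complex.I) := by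
    rw [Circle.coe_mul, Circle.coe_exp]; rfl
  have h1 : (((circleI * Circle.exp (-2 * θ) : Circle) : ℂ).re : ℂ) = Complex.sin (2 * θ) := by
    rw [h0, Complex.I_mul_re, Complex.exp_ofReal_mul_I_im]
    simp
  have h2 : (((circleI * Circle.exp (-2 * θ) : Circle) : ℂ).im : ℂ) = Complex.cos (2 * θ) := by
    rw [h0, Complex.I_mul_im, Complex.exp_ofReal_mul_I_re]
    simp
  rw [h1, h2]

theorem lowering_mem_weight {w : ℤ} {u : Smooth} (hu : u ∈ weight w) :
    lowering u ∈ weight (w - 2) := by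
  intro θ g
  rw [lowering_apply]
  change (1 / 2 : ℂ) * ((dcurveLM 1 u).1 (rot θ g)
      - Complex.I * (dcurveLM circleI u).1 (rot θ g)) = _ *
    ((1 / 2 : ℂ) * ((dcurveLM 1 u).1 g - Complex.I * (dcurveLM circleI u).1 g))
  rw [dcurveLM_one_rot hu, dcurveLM_circleI_rot hu]
  have : Complex.exp (((w - 2 : ℤ) : ℂ) * θ * Complex.I) = Complex.exp (w * θ * Complex.I)
      * (Complex.cos (2 * θ) - Complex.sin (2 * θ) * Complex.I) := by
    rw [show Complex.cos (2 * θ) - Complex.sin (2 * θ) * Complex.I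
        = Complex.exp (-(2 * θ) * Complex.I) by
      rw [Complex.exp_mul_I, Complex.cos_neg, Complex.sin_neg]; ring, ← Complex.exp_add]
    congr 1
    push_cast
    ring
  rw [this]
  linear_combination (1 / 2 : ℂ) * Complex.exp (w * θ * Complex.I) *
    (-Complex.sin (2 * θ) * (dcurveLM circleI u).1 g) * Complex.I_sq

theorem raising_mem_weight {w : ℤ} {u : Smooth} (hu : u ∈ weight w) :
    raising u ∈ weight (w + 2) := by
  intro θ g
  rw [raising_apply]
  change (1 / 2 : ℂ) * ((dcurveLM 1 u).1 (rot θ g)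
      + Complex.I * (dcurveLM circleI u).1 (rot θ g)) = _ *
    ((1 / 2 : ℂ) * ((dcurveLM 1 u).1 g + Complex.I * (dcurveLM circleI u).1 g))
  rw [dcurveLM_one_rot hu, dcurveLM_circleI_rot hu]
  have : Complex.exp (((w + 2 : ℤ) : ℂ) * θ * Complex.I) = Complex.exp (w * θ * Complex.I)
      * (Complex.cos (2 * θ) + Complex.sin (2 * θ) * Complex.I) := by
    rw [← Complex.exp_mul_I, ← Complex.exp_add]
    congr 1
    push_cast
    ring
  rw [this]
  linear_combination (1 / 2 : ℂ) * Complex.exp (w * θ * Complex.I) *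
    (-Complex.sin (2 * θ) * (dcurveLM circleI u).1 g) * Complex.I_sq

/-! ### Commutation relations -/

theorem fderiv_fderiv_perp {G : C2 → ℂ} (hG : ContDiff ℝ ∞ G) (c : ℂ) (x v : C2) :
    fderiv ℝ (fun y => fderiv ℝ G y (c • perp y)) x v =
      fderiv ℝ (fderiv ℝ G) x v (c • perp x) + fderiv ℝ G x (c • perp v) := by
  have h1 : HasFDerivAt (fderiv ℝ G) (fderiv ℝ (fderiv ℝ G) x) x :=
    ((hG.fderiv_right (m := ∞) (by simp)).differentiable (by simp) x).hasFDerivAt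
  have h := (h1.clm_apply (perpCLM c).hasFDerivAt).fderiv
  change fderiv ℝ (fun y => fderiv ℝ G y (perpCLM c y)) x v = _
  rw [h]
  simp [add_comm]

theorem fderiv_fiber {w : ℤ} {G : C2 → ℂ} (hG : ContDiff ℝ ∞ G)
    (hw : Smooth.restrict G hG ∈ weight w) (g : S3) :
    fderiv ℝ G g (Complex.I • (g : C2)) = w * Complex.I * G g := by
  have h1 : HasDerivAt (fun θ : ℝ => Complex.exp (θ * Complex.I)) Complex.I 0 := by
    have := ((Complex.ofRealCLM.hasDerivAt (x := 0)).mul_const Complex.I).cexp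
    simpa using this
  have h2 : HasDerivAt (fun θ : ℝ => Complex.exp (w * θ * Complex.I)) (w * Complex.I) 0 := by
    have := (((Complex.ofRealCLM.hasDerivAt (x := 0)).const_mul (w : ℂ)).mul_const Complex.I).cexp
    simpa using this
  have h3 : HasDerivAt (fun θ : ℝ => G (Complex.exp (θ * Complex.I) • (g : C2)))
      (fderiv ℝ G g (Complex.I • (g : C2))) 0 := by
    have hd := ((hG.differentiable (by simp)) (Complex.exp (((0 : ℝ) : ℂ) * Complex.I) •
      (g : C2))).hasFDerivAt.comp_hasDerivAt 0 (h1.smul_const (g : C2))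
    simpa [Function.comp_def] using hd
  have h4 : (fun θ : ℝ => G (Complex.exp (θ * Complex.I) • (g : C2))) =
      fun θ : ℝ => Complex.exp (w * θ * Complex.I) * G g := funext fun θ => hw θ g
  rw [h4] at h3
  exact h3.unique (h2.mul_const (G g))

/-- The second derivatives cancel by symmetry. The first-order terms that remain are derivatives in
the directions `∓i g`, tangent to the Hopf fibre, where a function of weight `w` is multiplied by
`∓i w`. -/
theorem dcurveLM_commutator {w : ℤ} {u : Smooth} (hu : u ∈ weight w) :
    dcurveLM 1 (dcurveLM circleI u) - dcurveLM circleI (dcurveLM 1 u)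
      = (-2 * w * Complex.I) • u := by
  obtain ⟨G, hG, rfl⟩ := Smooth.exists_ext u
  rw [dcurveLM_restrict, dcurveLM_restrict, dcurveLM_restrict, dcurveLM_restrict]
  ext g
  change fderiv ℝ (fun y => fderiv ℝ G y (_ • perp y)) g (_ • perp g)
    - fderiv ℝ (fun y => fderiv ℝ G y (_ • perp y)) g (_ • perp g) = _ * G g
  rw [fderiv_fderiv_perp hG, fderiv_fderiv_perp hG]
  have hs := (hG.contDiffAt (x := (g : C2))).isSymmSndFDerivAt (by simpa using ENat.LEInfty.out)
  rw [hs.eq]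
  have h1 : (circleI : ℂ) • perp (((1 : Circle) : ℂ) • perp (g : C2)) = -(Complex.I • (g : C2)) := by
    rw [Circle.coe_one, one_smul, perp_perp, smul_neg]; rfl
  have h2 : ((1 : Circle) : ℂ) • perp ((circleI : ℂ) • perp (g : C2)) = Complex.I • (g : C2) := by
    rw [perp_smul, perp_perp, Circle.coe_one, one_smul]
    simp [circleI]
  rw [h1, h2, map_neg, fderiv_fiber hG hu]
  ring

theorem lowering_raising_sub {w : ℤ} {u : Smooth} (hu : u ∈ weight w) :
    lowering (raising u) - raising (lowering u) = (w : ℂ) • u := by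
  have h := dcurveLM_commutator hu
  simp only [lowering_apply, raising_apply, map_smul, map_add, map_sub]
  have e : (w : ℂ) • u = (Complex.I / 2) • ((-2 * w * Complex.I) • u) := by
    rw [smul_smul]
    congr 1
    linear_combination (w : ℂ) * Complex.I_sq
  rw [e, ← h]
  module

theorem horizontal_laplacian_eq {w : ℤ} {u : Smooth} (hu : u ∈ weight w) :
    dcurveLM 1 (dcurveLM 1 u) + dcurveLM circleI (dcurveLM circleI u)
      = (4 : ℂ) • lowering (raising u) - (2 * w : ℂ) • u := by
  have h := dcurveLM_commutator hu
  simp only [lowering_apply, raising_apply, map_smul, map_add]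
  have e : (2 * w : ℂ) • u = Complex.I • ((-2 * w * Complex.I) • u) := by
    rw [smul_smul]
    congr 1
    linear_combination (2 * (w : ℂ)) * Complex.I_sq
  rw [e, ← h]
  -- The relation `i² = -1` must be inserted by hand, as `module` treats `i` as an indeterminate
  -- scalar.
  have hI : ∀ x : Smooth, x = -(Complex.I • (Complex.I • x)) := fun x => by
    rw [smul_smul, Complex.I_mul_I, neg_one_smul, neg_neg]
  conv_lhs => rw [hI (dcurveLM circleI (dcurveLM circleI u))]
  module

theorem lowering_mul (u v : Smooth) : lowering (u * v) = lowering u * v + u * lowering v := by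
  simp only [lowering_apply, dcurveLM_mul, smul_mul_assoc, mul_smul_comm, sub_mul, mul_sub]
  module

theorem raising_mul (u v : Smooth) : raising (u * v) = raising u * v + u * raising v := by
  simp only [raising_apply, dcurveLM_mul, smul_mul_assoc, mul_smul_comm, add_mul, mul_add]
  module

/-- Complex conjugation of smooth functions. -/
def conj (u : Smooth) : Smooth :=
  ⟨fun g => (starRingEnd ℂ) (u.1 g), by
    obtain ⟨G, hG, rfl⟩ := Smooth.exists_ext u
    exact contMDiff_restrict (Complex.conjCLE.contDiff.comp hG)⟩

theorem dcurveLM_conj (c : Circle) (u : Smooth) : dcurveLM c (conj u) = conj (dcurveLM c u) := by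
  obtain ⟨G, hG, rfl⟩ := Smooth.exists_ext u
  ext g
  have h := (Complex.conjCLE.toContinuousLinearMap.hasFDerivAt.comp_hasDerivAt 0
    (hasDerivAt_comp_curve hG c g 0)).deriv
  rw [curve_zero] at h
  rw [dcurveLM_restrict]
  exact h

theorem lowering_conj (u : Smooth) : lowering (conj u) = conj (raising u) := by
  ext g
  rw [lowering_apply, raising_apply, dcurveLM_conj, dcurveLM_conj]
  change (1 / 2 : ℂ) * ((starRingEnd ℂ) ((dcurveLM 1 u).1 g)
      - Complex.I * (starRingEnd ℂ) ((dcurveLM circleI u).1 g)) =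
    (starRingEnd ℂ) ((1 / 2 : ℂ) * ((dcurveLM 1 u).1 g + Complex.I * (dcurveLM circleI u).1 g))
  simp only [map_mul, map_add, map_div₀, map_one, map_ofNat, Complex.conj_I]
  ring

/-! ### The Hermite functions -/

theorem derivative_hermite_succ (n : ℕ) :
    Polynomial.derivative (Polynomial.hermite (n + 1)) =
      ((n : Polynomial ℤ) + 1) * Polynomial.hermite n := by
  induction n with
  | zero => simp
  | succ n ih =>
    rw [Polynomial.hermite_succ (n + 1), Polynomial.derivative_sub, Polynomial.derivative_mul, ih,
      Polynomial.derivative_X, Polynomial.derivative_mul, Polynomial.derivative_add,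
      Polynomial.derivative_natCast, Polynomial.derivative_one]
    have := Polynomial.hermite_succ n
    push_cast
    linear_combination (-(n : Polynomial ℤ) - 1) * this

theorem hermite_equation (n : ℕ) :
    Polynomial.derivative (Polynomial.derivative (Polynomial.hermite n))
      - Polynomial.X * Polynomial.derivative (Polynomial.hermite n)
      + (n : Polynomial ℤ) * Polynomial.hermite n = 0 := by
  cases n with
  | zero => simp
  | succ n =>
    rw [derivative_hermite_succ, Polynomial.derivative_mul, Polynomial.derivative_add,
      Polynomial.derivative_natCast, Polynomial.derivative_one]
    have := Polynomial.hermite_succ n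
    push_cast
    linear_combination ((n : Polynomial ℤ) + 1) * this

/-- The derivative of the Hermite function. -/
def hermiteFunDeriv (l : ℕ) (x : ℝ) : ℝ :=
  (√2 * (Polynomial.aeval (√2 * x) (Polynomial.derivative (Polynomial.hermite l)) : ℝ)
    - x * (Polynomial.aeval (√2 * x) (Polynomial.hermite l) : ℝ)) * Real.exp (-x ^ 2 / 2) /
      √(√Real.pi * (l.factorial : ℝ))

theorem hasDerivAt_aeval_sqrt_two (p : Polynomial ℤ) (x : ℝ) :
    HasDerivAt (fun y : ℝ => (Polynomial.aeval (√2 * y) p : ℝ))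
      (√2 * (Polynomial.aeval (√2 * x) (Polynomial.derivative p) : ℝ)) x := by
  have h := (p.hasDerivAt_aeval (√2 * x)).comp x ((hasDerivAt_id x).const_mul √2)
  simpa [mul_comm, Function.comp_def] using h

theorem hasDerivAt_gaussian (x : ℝ) :
    HasDerivAt (fun y : ℝ => Real.exp (-y ^ 2 / 2)) (-x * Real.exp (-x ^ 2 / 2)) x := by
  have h := (((hasDerivAt_pow 2 x).neg).div_const 2).exp
  refine h.congr_deriv ?_
  simp
  ring

theorem hasDerivAt_hermiteFun (l : ℕ) (x : ℝ) :
    HasDerivAt (hermiteFun l) (hermiteFunDeriv l x) x := by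
  have h := ((hasDerivAt_aeval_sqrt_two (Polynomial.hermite l) x).mul
    (hasDerivAt_gaussian x)).div_const (√(√Real.pi * (l.factorial : ℝ)))
  refine h.congr_deriv ?_
  rw [hermiteFunDeriv]
  ring

/-- The Hermite differential equation, rescaled by `√2` from the probabilists' polynomials. It says
that `h_l'' - x² h_l = -(2l+1) h_l`, so `e·e + f·f` acts on `h_l` as `2 q_l`. -/
theorem hasDerivAt_hermiteFunDeriv (l : ℕ) (x : ℝ) :
    HasDerivAt (hermiteFunDeriv l) ((x ^ 2 - (2 * l + 1)) * hermiteFun l x) x := by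
  have h := (((((hasDerivAt_aeval_sqrt_two (Polynomial.derivative (Polynomial.hermite l)) x).const_mul
    √2).sub ((hasDerivAt_id x).mul (hasDerivAt_aeval_sqrt_two (Polynomial.hermite l) x))).mul
    (hasDerivAt_gaussian x))).div_const (√(√Real.pi * (l.factorial : ℝ)))
  refine h.congr_deriv ?_
  have e := congrArg (fun p => (Polynomial.aeval (√2 * x) p : ℝ)) (hermite_equation l)
  simp only [map_add, map_sub, map_mul, Polynomial.aeval_X, map_natCast, map_zero] at e
  have h2 : √2 * √2 = (2 : ℝ) := Real.mul_self_sqrt (by norm_num)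
  rw [hermiteFun, ← mul_div_assoc]
  congr 1
  simp only [id, Pi.sub_apply, Pi.mul_apply]
  linear_combination (2 * Real.exp (-x ^ 2 / 2)) * e + Real.exp (-x ^ 2 / 2) *
    (Polynomial.aeval (√2 * x) (Polynomial.derivative (Polynomial.derivative
      (Polynomial.hermite l))) : ℝ) * h2

/-! ### The Laplacian on decomposable spinor fields -/

/-- The spinor field `g ↦ u(g) h`. -/
def tensor (u : Smooth) (h : ℝ → ℂ) : SpinorField := fun g x => u.1 g * h x

theorem differentiableAt_comp_curve (u : Smooth) (c : Circle) (g : S3) (t : ℝ) :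
    DifferentiableAt ℝ (fun s => u.1 (curve c g s)) t := by
  obtain ⟨G, hG, rfl⟩ := Smooth.exists_ext u
  exact (hasDerivAt_comp_curve hG c g t).differentiableAt

/-- Either Dirac operator sends one decomposable field to a sum of two, and the second application
must handle that sum. The calculus is therefore set up for sums of two, a single term being padded
by zero. -/
theorem deriv_tensor_add_curve (c : Circle) (u v : Smooth) (h k : ℝ → ℂ) (g : S3) (x : ℝ) :
    deriv (fun t => (tensor u h + tensor v k) (curve c g t) x) 0 =
      (tensor (dcurveLM c u) h + tensor (dcurveLM c v) k) g x := by
  change deriv (fun t => u.1 (curve c g t) * h x + v.1 (curve c g t) * k x) 0 = _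
  rw [deriv_fun_add ((differentiableAt_comp_curve u c g 0).mul_const _)
    ((differentiableAt_comp_curve v c g 0).mul_const _), deriv_mul_const_field,
    deriv_mul_const_field]
  rfl

theorem nablaE_tensor_add (u v : Smooth) (h k : ℝ → ℂ) :
    nablaE (tensor u h + tensor v k) = tensor (dcurveLM 1 u) h + tensor (dcurveLM 1 v) k := by
  ext g x
  exact deriv_tensor_add_curve 1 u v h k g x

theorem nablaF_tensor_add (u v : Smooth) (h k : ℝ → ℂ) :
    nablaF (tensor u h + tensor v k) =
      tensor (dcurveLM circleI u) h + tensor (dcurveLM circleI v) k := by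
  ext g x
  exact deriv_tensor_add_curve circleI u v h k g x

theorem cliffF_tensor_add (u v : Smooth) {h k h' k' : ℝ → ℂ} (hh : ∀ x, HasDerivAt h (h' x) x)
    (hk : ∀ x, HasDerivAt k (k' x) x) :
    cliffF (tensor u h + tensor v k) = tensor u h' + tensor v k' := by
  ext g x
  exact (((hh x).const_mul (u.1 g)).add ((hk x).const_mul (v.1 g))).deriv

theorem cliffE_tensor_add (u v : Smooth) (h k : ℝ → ℂ) :
    cliffE (tensor u h + tensor v k) =
      tensor u (fun x => Complex.I * x * h x) + tensor v (fun x => Complex.I * x * k x) := by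
  ext g x
  simp only [cliffE, tensor, Pi.add_apply]
  ring

theorem tensor_zero_left (h : ℝ → ℂ) : tensor 0 h = 0 := by
  ext g x
  exact zero_mul _

theorem dirac_tensor_add (u v : Smooth) {h k h' k' : ℝ → ℂ} (hh : ∀ x, HasDerivAt h (h' x) x)
    (hk : ∀ x, HasDerivAt k (k' x) x) :
    dirac (tensor u h + tensor v k) =
      tensor (dcurveLM circleI u) (fun x => Complex.I * x * h x)
        + tensor (dcurveLM circleI v) (fun x => Complex.I * x * k x)
        - (tensor (dcurveLM 1 u) h' + tensor (dcurveLM 1 v) k') := by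
  rw [dirac, nablaF_tensor_add, nablaE_tensor_add, cliffE_tensor_add, cliffF_tensor_add _ _ hh hk]

theorem diracTilde_tensor_add (u v : Smooth) {h k h' k' : ℝ → ℂ}
    (hh : ∀ x, HasDerivAt h (h' x) x) (hk : ∀ x, HasDerivAt k (k' x) x) :
    diracTilde (tensor u h + tensor v k) =
      tensor (dcurveLM 1 u) (fun x => Complex.I * x * h x)
        + tensor (dcurveLM 1 v) (fun x => Complex.I * x * k x)
        + (tensor (dcurveLM circleI u) h' + tensor (dcurveLM circleI v) k') := by
  rw [diracTilde, nablaF_tensor_add, nablaE_tensor_add, cliffE_tensor_add,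
    cliffF_tensor_add _ _ hh hk]

/-- On decomposable fields the Laplacian is `i (e·e + f·f) [∇_e, ∇_f] - ∇_e² - ∇_f²`. -/
theorem laplacianP_tensor (u : Smooth) {h h' h'' : ℝ → ℂ} (hh : ∀ x, HasDerivAt h (h' x) x)
    (hh' : ∀ x, HasDerivAt h' (h'' x) x) :
    laplacianP (tensor u h) =
      tensor (dcurveLM 1 (dcurveLM circleI u) - dcurveLM circleI (dcurveLM 1 u))
        (fun x => Complex.I * (h'' x - x ^ 2 * h x))
      - tensor (dcurveLM 1 (dcurveLM 1 u) + dcurveLM circleI (dcurveLM circleI u)) h := by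
  have hx : ∀ x : ℝ, HasDerivAt (fun y : ℝ => Complex.I * y * h y)
      (Complex.I * h x + Complex.I * x * h' x) x := fun x => by
    have := (((Complex.ofRealCLM.hasDerivAt (x := x)).const_mul Complex.I).mul (hh x))
    refine this.congr_deriv ?_
    simp
  have h0 : tensor u h = tensor u h + tensor 0 h := by rw [tensor_zero_left, add_zero]
  have hD : dirac (tensor u h) = tensor (dcurveLM circleI u) (fun x => Complex.I * x * h x)
      + tensor (-dcurveLM 1 u) h' := by
    rw [h0, dirac_tensor_add u 0 hh hh]
    ext g x
    simp only [map_zero, tensor_zero_left, add_zero]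
    change _ - (dcurveLM 1 u).1 g * h' x = _ + -((dcurveLM 1 u).1 g) * h' x
    ring
  have hT : diracTilde (tensor u h) = tensor (dcurveLM 1 u) (fun x => Complex.I * x * h x)
      + tensor (dcurveLM circleI u) h' := by
    rw [h0, diracTilde_tensor_add u 0 hh hh]
    simp only [map_zero, tensor_zero_left, add_zero]
  rw [laplacianP, hD, hT, dirac_tensor_add _ _ hx hh', diracTilde_tensor_add _ _ hx hh', map_neg,
    map_neg]
  ext g x
  change Complex.I * (((dcurveLM 1 (dcurveLM circleI u)).1 g * (Complex.I * x * (Complex.I * x * h x))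
      + -(dcurveLM 1 (dcurveLM 1 u)).1 g * (Complex.I * x * h' x)
      + ((dcurveLM circleI (dcurveLM circleI u)).1 g * (Complex.I * h x + Complex.I * x * h' x)
      + -(dcurveLM circleI (dcurveLM 1 u)).1 g * h'' x))
      - ((dcurveLM circleI (dcurveLM 1 u)).1 g * (Complex.I * x * (Complex.I * x * h x))
      + (dcurveLM circleI (dcurveLM circleI u)).1 g * (Complex.I * x * h' x)
      - ((dcurveLM 1 (dcurveLM 1 u)).1 g * (Complex.I * h x + Complex.I * x * h' x)
      + (dcurveLM 1 (dcurveLM circleI u)).1 g * h'' x))) =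
    ((dcurveLM 1 (dcurveLM circleI u)).1 g - (dcurveLM circleI (dcurveLM 1 u)).1 g)
      * (Complex.I * (h'' x - x ^ 2 * h x))
    - ((dcurveLM 1 (dcurveLM 1 u)).1 g + (dcurveLM circleI (dcurveLM circleI u)).1 g) * h x
  linear_combination (((dcurveLM 1 (dcurveLM circleI u)).1 g - (dcurveLM circleI (dcurveLM 1 u)).1 g)
    * Complex.I * x ^ 2 * h x + ((dcurveLM 1 (dcurveLM 1 u)).1 g
      + (dcurveLM circleI (dcurveLM circleI u)).1 g) * h x) * Complex.I_sq

/-! ### The operator on the sections of `Q_l` -/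

/-- The equivariance exponent `-2 q_l` is the odd integer `2l+1`, which allows the weight formalism.
-/
theorem mem_sections_iff (l : ℕ) (u : Smooth) : u.1 ∈ sections l ↔ u ∈ weight (2 * l + 1) := by
  have e : ∀ θ : ℝ, -(2 * (θ : ℂ) * (charge l : ℂ)) * Complex.I =
      (((2 * l + 1 : ℤ)) : ℂ) * θ * Complex.I := fun θ => by
    simp only [charge]
    push_cast
    ring
  change (_ ∧ ∀ (θ : ℝ) (g : S3), _ = Complex.exp (-(2 * (θ : ℂ) * (charge l : ℂ)) * Complex.I) * _)
    ↔ _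
  simp only [e]
  exact ⟨fun h => h.2, fun h => ⟨u.2, h⟩⟩

/-- The inclusion of the sections of `Q_l` into the smooth functions. -/
def toSmooth (l : ℕ) : sections l →ₗ[ℂ] Smooth where
  toFun u := ⟨u.1, u.2.1⟩
  map_add' _ _ := rfl
  map_smul' _ _ := rfl

theorem toSmooth_mem_weight (l : ℕ) (u : sections l) : toSmooth l u ∈ weight (2 * l + 1) :=
  (mem_sections_iff l (toSmooth l u)).1 u.2

/-- A function of weight `2 l + 1` as a section of `Q_l`. -/
def ofWeight {l : ℕ} (u : Smooth) (hu : u ∈ weight (2 * l + 1)) : sections l :=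
  ⟨u.1, (mem_sections_iff l u).2 hu⟩

theorem lowering_raising_mem_weight {w : ℤ} {u : Smooth} (hu : u ∈ weight w) :
    lowering (raising u) ∈ weight w := by
  simpa using lowering_mem_weight (raising_mem_weight hu)

/-- The restriction of the Laplacian to the sections of `Q_l`. -/
def restrictedLaplacian (l : ℕ) : Module.End ℂ (sections l) where
  toFun u := ofWeight ((-(4 * (2 * l + 1) * l) : ℂ) • toSmooth l u
      - (4 : ℂ) • lowering (raising (toSmooth l u)))
    ((weight _).sub_mem ((weight _).smul_mem _ (toSmooth_mem_weight l u))
      ((weight _).smul_mem _ (lowering_raising_mem_weight (toSmooth_mem_weight l u))))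
  map_add' u v := by
    apply Subtype.ext
    simp only [ofWeight, map_add, smul_add]
    ext g
    simp
    ring
  map_smul' c u := by
    apply Subtype.ext
    simp only [ofWeight, map_smul]
    ext g
    simp
    ring

theorem toSmooth_restrictedLaplacian (l : ℕ) (u : sections l) :
    toSmooth l (restrictedLaplacian l u) = (-(4 * (2 * l + 1) * l) : ℂ) • toSmooth l u
      - (4 : ℂ) • lowering (raising (toSmooth l u)) := rfl

/-- With `w = 2l+1`, the curvature term is `i·(-w)·(-2iw) = -2w²` and the horizontal Laplacian
contributes `2w - 4·lowering∘raising`. The scalars add up to `-2w(w-1) = -4l(2l+1)`. -/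
theorem isRestriction_restrictedLaplacian (l : ℕ) : IsRestriction l (restrictedLaplacian l) := by
  intro u
  have hw := toSmooth_mem_weight l u
  have h1 : ∀ x : ℝ, HasDerivAt (fun y => (hermiteFun l y : ℂ)) (hermiteFunDeriv l x : ℂ) x :=
    fun x => (hasDerivAt_hermiteFun l x).ofReal_comp
  have h2 : ∀ x : ℝ, HasDerivAt (fun y => (hermiteFunDeriv l y : ℂ))
      (((x ^ 2 - (2 * l + 1)) * hermiteFun l x : ℝ) : ℂ) x :=
    fun x => (hasDerivAt_hermiteFunDeriv l x).ofReal_comp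
  have h3 := laplacianP_tensor (toSmooth l u) h1 h2
  rw [dcurveLM_commutator hw, horizontal_laplacian_eq hw] at h3
  change tensor (toSmooth l (restrictedLaplacian l u)) _ = laplacianP (tensor (toSmooth l u) _)
  rw [h3, toSmooth_restrictedLaplacian]
  ext g x
  change (_ * (toSmooth l u).1 g - 4 * (lowering (raising (toSmooth l u))).1 g) * _
    = _ * (toSmooth l u).1 g * _ - (4 * (lowering (raising (toSmooth l u))).1 g
      - _ * (toSmooth l u).1 g) * _
  push_cast
  linear_combination -(2 * (2 * l + 1) ^ 2 : ℂ) * (toSmooth l u).1 g * (hermiteFun l x : ℂ)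
    * Complex.I_sq

/-! ### Invariance of the measure -/

theorem norm_map_of_sphere {A : C2 →ₗ[ℝ] C2} (hA : ∀ g : S3, ‖A g‖ = 1) (x : C2) :
    ‖A x‖ = ‖x‖ := by
  by_cases hx : x = 0
  · simp [hx]
  · have h := hA (radial x hx)
    have hn : ‖x‖ ≠ 0 := norm_ne_zero_iff.2 hx
    simp only [radial, map_smul, norm_smul, norm_inv, norm_norm] at h
    field_simp at h
    exact h

open scoped Pointwise in
/-- A self-map of the sphere induced by a real-linear map preserves the measure. -/
theorem measurePreserving_of_linear {f : S3 → S3} (A : C2 →ₗ[ℝ] C2)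
    (hf : ∀ g, (f g : C2) = A g) : MeasurePreserving f hopfMeasure hopfMeasure := by
  let B : C2 ≃ₗᵢ[ℝ] C2 := LinearIsometry.toLinearIsometryEquiv
    ⟨A, norm_map_of_sphere fun g => by rw [← hf, norm_coe_sphere]⟩ rfl
  have hB : ∀ x, B x = A x := fun x => rfl
  have hfc : Continuous f := by
    refine continuous_induced_rng.2 ?_
    have : (fun g : S3 => B g) = Subtype.val ∘ f := funext fun g => (hf g).symm
    rw [← this]
    exact B.continuous.comp continuous_subtype_val
  refine ⟨hfc.measurable, ?_⟩
  unfold hopfMeasure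
  rw [Measure.map_smul]
  congr 1
  ext s hs
  rw [Measure.map_apply hfc.measurable hs, Measure.toSphere_apply' _ hs,
    Measure.toSphere_apply' _ (hfc.measurable hs)]
  congr 1
  -- The sphere measure of `s` is a multiple of the volume of the cone `(0,1)•s`. The isometry `B`
  -- carries cones to cones and preserves volume.
  have hset : Set.Ioo (0 : ℝ) 1 • ((↑) '' (f ⁻¹' s) : Set C2) =
      B ⁻¹' (Set.Ioo (0 : ℝ) 1 • ((↑) '' s : Set C2)) := by
    ext x
    simp only [Set.mem_smul, Set.mem_image, Set.mem_preimage]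
    constructor
    · rintro ⟨r, hr, _, ⟨g, hg, rfl⟩, rfl⟩
      exact ⟨r, hr, _, ⟨f g, hg, rfl⟩, by rw [map_smul, hB, ← hf]⟩
    · rintro ⟨r, hr, _, ⟨g, hg, rfl⟩, h⟩
      have hg1 : B.symm g ∈ sphere (0 : C2) 1 := by
        rw [mem_sphere_iff_norm, sub_zero, B.symm.norm_map, norm_coe_sphere]
      refine ⟨r, hr, _, ⟨⟨B.symm g, hg1⟩, ?_, rfl⟩, ?_⟩
      · have : f ⟨B.symm g, hg1⟩ = g := by
          apply Subtype.ext
          rw [hf, ← hB]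
          exact B.apply_symm_apply _
        rwa [this]
      · change r • B.symm g = x
        rw [← map_smul, h, B.symm_apply_apply]
  rw [hset]
  exact B.measurePreserving.measure_preimage_emb
    B.toHomeomorph.toMeasurableEquiv.measurableEmbedding _

theorem measurePreserving_curve (c : Circle) (t : ℝ) :
    MeasurePreserving (fun g => curve c g t) hopfMeasure hopfMeasure :=
  measurePreserving_of_linear ((Real.cos t • (ContinuousLinearMap.id ℝ C2)
      + Real.sin t • perpCLM c : C2 →L[ℝ] C2) : C2 →ₗ[ℝ] C2) fun g => by
    simp [curve, mul_smul, ← Complex.coe_smul]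

theorem measurePreserving_rot (θ : ℝ) : MeasurePreserving (rot θ) hopfMeasure hopfMeasure :=
  measurePreserving_of_linear
    ((LinearMap.lsmul ℂ C2 (Complex.exp (θ * Complex.I))).restrictScalars ℝ) fun _ => rfl

/-- The action of a circle on the first coordinate. -/
def torus (c : Circle) (g : S3) : S3 :=
  ⟨!₂[(c : ℂ) * g.1 0, g.1 1], by
    have h := norm_coe_sphere g
    rw [EuclideanSpace.norm_eq] at h
    rw [mem_sphere_iff_norm, sub_zero, EuclideanSpace.norm_eq]
    refine Eq.trans ?_ h
    have hc : ‖(c : ℂ)‖ = 1 := Circle.norm_coe c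
    simp only [Fin.sum_univ_two, Matrix.cons_val_zero, Matrix.cons_val_one, norm_mul, hc,
      one_mul]⟩

theorem measurePreserving_torus (c : Circle) :
    MeasurePreserving (torus c) hopfMeasure hopfMeasure :=
  measurePreserving_of_linear
    { toFun := fun x => !₂[(c : ℂ) * x 0, x 1]
      map_add' := fun x y => by
        ext i
        fin_cases i <;> simp [mul_add]
      map_smul' := fun r x => by
        ext i
        fin_cases i <;> simp [mul_left_comm] } fun _ => rfl

/-- This makes a continuous function determined by its `L²` class, hence `smoothToL2_injective`. -/
instance isOpenPosMeasure_hopfMeasure : hopfMeasure.IsOpenPosMeasure := by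
  refine ⟨fun U hU hne => ?_⟩
  unfold hopfMeasure
  have h := hU.measure_ne_zero ((volume : Measure C2).toSphere) hne
  have hpi : Real.toNNReal (1 / (2 * Real.pi)) ≠ 0 := by
    have : 0 < 1 / (2 * Real.pi) := by positivity
    simpa using this
  rw [Measure.smul_apply, ENNReal.smul_def, smul_eq_mul]
  exact mul_ne_zero (by simpa using hpi) h

/-! ### The `L²` inner product of smooth functions -/

theorem Smooth.continuous (u : Smooth) : Continuous u.1 := u.2.continuous

theorem Smooth.integrable (u : Smooth) : Integrable u.1 hopfMeasure :=
  (Smooth.continuous u).integrable_of_hasCompactSupport (HasCompactSupport.of_compactSpace _)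

/-- The `L²` class of a smooth function. -/
def smoothToL2 : Smooth →ₗ[ℂ] Lp ℂ 2 hopfMeasure where
  toFun u := ContinuousMap.toLp 2 hopfMeasure ℂ ⟨u, Smooth.continuous u⟩
  map_add' u v := by rw [← map_add]; rfl
  map_smul' c u := by rw [RingHom.id_apply, ← map_smul]; rfl

theorem toL2_eq (l : ℕ) (u : sections l) : toL2 l u = smoothToL2 (toSmooth l u) := rfl

theorem smoothToL2_injective : Function.Injective smoothToL2 := by
  intro u v h
  have := ContinuousMap.toLp_injective (p := 2) (𝕜 := ℂ) hopfMeasure h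
  exact Subtype.ext (congrArg (fun f : C(S3, ℂ) => (f : S3 → ℂ)) this)

theorem inner_smoothToL2 (u v : Smooth) :
    inner ℂ (smoothToL2 u) (smoothToL2 v) = ∫ g, (conj u * v).1 g ∂hopfMeasure := by
  refine (ContinuousMap.inner_toLp hopfMeasure _ _).trans ?_
  refine integral_congr_ae (Eventually.of_forall fun g => ?_)
  exact mul_comm _ _

/-- Moving along the circles for time `t` is a real-linear isometry, so the integral of `u(curve c g
t)` is independent of `t`. Differentiation under the integral sign at `0` gives the vanishing. -/
theorem integral_dcurveLM (c : Circle) (u : Smooth) :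
    ∫ g, (dcurveLM c u).1 g ∂hopfMeasure = 0 := by
  have hderiv : ∀ (g : S3) (t : ℝ),
      HasDerivAt (fun s => u.1 (curve c g s)) ((dcurveLM c u).1 (curve c g t)) t := by
    obtain ⟨G, hG, rfl⟩ := Smooth.exists_ext u
    intro g t
    rw [dcurveLM_restrict]
    exact hasDerivAt_comp_curve hG c g t
  obtain ⟨C, hC⟩ := (isCompact_range (Smooth.continuous (dcurveLM c u)).norm).bddAbove
  have hmp := measurePreserving_curve c
  have hint : ∀ (v : Smooth) (t : ℝ), Integrable (fun g => v.1 (curve c g t)) hopfMeasure :=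
    fun v t => ((hmp t).integrable_comp (Smooth.integrable v).aestronglyMeasurable).2
      (Smooth.integrable v)
  have h := (hasDerivAt_integral_of_dominated_loc_of_deriv_le (μ := hopfMeasure)
    (F := fun t g => u.1 (curve c g t)) (F' := fun t g => (dcurveLM c u).1 (curve c g t))
    (x₀ := 0) (bound := fun _ => C) (s := Set.univ) univ_mem
    (Eventually.of_forall fun t => (hint u t).aestronglyMeasurable) (hint u 0)
    (hint (dcurveLM c u) 0).aestronglyMeasurable
    (Eventually.of_forall fun g t _ => hC ⟨curve c g t, rfl⟩) (integrable_const C)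
    (Eventually.of_forall fun g t _ => hderiv g t)).2
  have hconst : (fun t => ∫ g, u.1 (curve c g t) ∂hopfMeasure) =
      fun _ => ∫ g, u.1 g ∂hopfMeasure := by
    ext t
    have := (hmp t).map_eq
    conv_rhs => rw [← this]
    exact (integral_map (hmp t).aemeasurable
      (Smooth.continuous u).aestronglyMeasurable).symm
  rw [hconst] at h
  have := h.unique (hasDerivAt_const 0 _)
  simpa only [curve_zero] using this

theorem integral_lowering (u : Smooth) : ∫ g, (lowering u).1 g ∂hopfMeasure = 0 := by
  rw [lowering_apply]
  change ∫ g, (1 / 2 : ℂ) * ((dcurveLM 1 u).1 g - Complex.I * (dcurveLM circleI u).1 g)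
    ∂hopfMeasure = 0
  rw [integral_const_mul, integral_sub (Smooth.integrable _)
    ((Smooth.integrable (dcurveLM circleI u)).const_mul _), integral_const_mul, integral_dcurveLM,
    integral_dcurveLM]
  simp

/-- Integration by parts: the integral of `lowering (conj u * v)` vanishes, and conjugation
exchanges `lowering` with `raising`. -/
theorem inner_lowering (u v : Smooth) :
    inner ℂ (smoothToL2 u) (smoothToL2 (lowering v)) =
      -inner ℂ (smoothToL2 (raising u)) (smoothToL2 v) := by
  rw [inner_smoothToL2, inner_smoothToL2, ← lowering_conj]
  have h := integral_lowering (conj u * v)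
  rw [lowering_mul] at h
  change ∫ g, (lowering (conj u) * v).1 g + (conj u * lowering v).1 g ∂hopfMeasure = 0 at h
  rw [integral_add (Smooth.integrable _) (Smooth.integrable _)] at h
  exact eq_neg_of_add_eq_zero_right h

theorem inner_raising (u v : Smooth) :
    inner ℂ (smoothToL2 u) (smoothToL2 (raising v)) =
      -inner ℂ (smoothToL2 (lowering u)) (smoothToL2 v) := by
  rw [← inner_conj_symm, ← inner_conj_symm (smoothToL2 (lowering u)), inner_lowering, map_neg,
    neg_neg]

theorem inner_lowering_raising (u v : Smooth) :
    inner ℂ (smoothToL2 u) (smoothToL2 (lowering (raising v))) =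
      inner ℂ (smoothToL2 (lowering (raising u))) (smoothToL2 v) := by
  rw [inner_lowering, inner_raising, neg_neg]

theorem integral_eq_zero_of_comp {f : S3 → S3} (hf : MeasurePreserving f hopfMeasure hopfMeasure)
    (u : Smooth) {a : ℂ} (ha : a ≠ 1) (h : ∀ g, u.1 (f g) = a * u.1 g) :
    ∫ g, u.1 g ∂hopfMeasure = 0 := by
  have h1 : ∫ g, u.1 g ∂hopfMeasure = a * ∫ g, u.1 g ∂hopfMeasure := by
    conv_lhs => rw [← hf.map_eq]
    rw [integral_map hf.aemeasurable (Smooth.continuous u).aestronglyMeasurable,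
      ← integral_const_mul]
    simp only [h]
  have h2 : (1 - a) * ∫ g, u.1 g ∂hopfMeasure = 0 := by linear_combination h1
  exact (mul_eq_zero.1 h2).resolve_left (sub_ne_zero.2 ha.symm)

theorem inner_eq_zero_of_weight_ne {w w' : ℤ} (hw : w ≠ w') {u v : Smooth} (hu : u ∈ weight w)
    (hv : v ∈ weight w') : inner ℂ (smoothToL2 u) (smoothToL2 v) = 0 := by
  rw [inner_smoothToL2]
  have hne : ((w' : ℂ) - w) ≠ 0 := sub_ne_zero.2 (by exact_mod_cast hw.symm)
  -- Rotation by this angle multiplies the integrand by `e^{i(w'-w)θ} = -1`, while the measure is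
  -- invariant.
  set θ : ℝ := Real.pi / ((w' : ℝ) - w) with hθ
  have hne' : ((w' : ℝ) - w) ≠ 0 := sub_ne_zero.2 (by exact_mod_cast hw.symm)
  refine integral_eq_zero_of_comp (measurePreserving_rot θ) _ (a := -1) (by norm_num) fun g => ?_
  change (starRingEnd ℂ) (u.1 (rot θ g)) * v.1 (rot θ g) = -1 * ((starRingEnd ℂ) (u.1 g) * v.1 g)
  rw [hu, hv, map_mul, ← Complex.exp_conj]
  have e : Complex.exp ((starRingEnd ℂ) (w * θ * Complex.I)) * Complex.exp (w' * θ * Complex.I)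
      = -1 := by
    rw [← Complex.exp_add, ← Complex.exp_pi_mul_I]
    congr 1
    simp only [map_mul, Complex.conj_I, Complex.conj_ofReal, map_intCast]
    have : (θ : ℂ) * ((w' : ℂ) - w) = Real.pi := by
      rw [hθ]
      push_cast
      field_simp
    linear_combination Complex.I * this
  linear_combination ((starRingEnd ℂ) (u.1 g) * v.1 g) * e

/-! ### Coordinates and holomorphic monomials -/

/-- The coordinate functions on the sphere. -/
def coord (i : Fin 2) : Smooth :=
  Smooth.restrict ((EuclideanSpace.proj (𝕜 := ℂ) i).restrictScalars ℝ : C2 →L[ℝ] ℂ)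
    (ContinuousLinearMap.contDiff _)

theorem dcurveLM_coord (c : Circle) (i : Fin 2) (g : S3) :
    (dcurveLM c (coord i)).1 g = (c : ℂ) * perp g i := by
  rw [coord, dcurveLM_restrict]
  change fderiv ℝ ((EuclideanSpace.proj (𝕜 := ℂ) i).restrictScalars ℝ : C2 →L[ℝ] ℂ) g
    ((c : ℂ) • perp g) = _
  rw [ContinuousLinearMap.fderiv]
  simp

theorem lowering_coord (i : Fin 2) (g : S3) : (lowering (coord i)).1 g = perp g i := by
  rw [lowering_apply]
  change (1 / 2 : ℂ) * ((dcurveLM 1 (coord i)).1 g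
    - Complex.I * (dcurveLM circleI (coord i)).1 g) = _
  rw [dcurveLM_coord, dcurveLM_coord]
  change (1 / 2 : ℂ) * (1 * _ - Complex.I * (Complex.I * _)) = _
  linear_combination (-(1 / 2 : ℂ) * perp g i) * Complex.I_sq

/-- The derivative of a coordinate in the direction `c • perp g` is complex-linear in `c`, so the
combination `∇_e + i∇_f` yields the factor `1 + i² = 0`. Monomials in the coordinates are thus
highest weight vectors. -/
theorem raising_coord (i : Fin 2) : raising (coord i) = 0 := by
  ext g
  rw [raising_apply]
  change (1 / 2 : ℂ) * ((dcurveLM 1 (coord i)).1 g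
    + Complex.I * (dcurveLM circleI (coord i)).1 g) = 0
  rw [dcurveLM_coord, dcurveLM_coord]
  change (1 / 2 : ℂ) * (1 * _ + Complex.I * (Complex.I * _)) = 0
  linear_combination ((1 / 2 : ℂ) * perp g i) * Complex.I_sq

theorem lowering_coord_zero : lowering (coord 0) = (-1 : ℂ) • conj (coord 1) := by
  ext g
  exact (lowering_coord 0 g).trans (neg_one_mul _).symm

theorem lowering_coord_one : lowering (coord 1) = conj (coord 0) := by
  ext g
  exact lowering_coord 1 g

theorem lowering_conj_coord (i : Fin 2) : lowering (conj (coord i)) = 0 := by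
  rw [lowering_conj, raising_coord]
  ext g
  exact map_zero _

theorem coord_mul_conj_add :
    coord 0 * conj (coord 0) + coord 1 * conj (coord 1) = 1 := by
  ext g
  change g.1 0 * (starRingEnd ℂ) (g.1 0) + g.1 1 * (starRingEnd ℂ) (g.1 1) = 1
  have h := norm_coe_sphere g
  have h2 : ‖(g : C2)‖ ^ 2 = 1 := by rw [h, one_pow]
  rw [EuclideanSpace.norm_sq_eq, Fin.sum_univ_two, ← Complex.normSq_eq_norm_sq,
    ← Complex.normSq_eq_norm_sq] at h2
  rw [Complex.mul_conj, Complex.mul_conj]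
  rw [← Complex.ofReal_add, h2, Complex.ofReal_one]

theorem lowering_pow (u : Smooth) (n : ℕ) :
    lowering (u ^ (n + 1)) = ((n : ℂ) + 1) • (u ^ n * lowering u) := by
  induction n with
  | zero => simp
  | succ n ih =>
    rw [pow_succ, lowering_mul, ih, smul_mul_assoc, mul_right_comm, ← pow_succ]
    push_cast
    module

/-- The holomorphic monomials. -/
def mono (a b : ℕ) : Smooth := coord 0 ^ a * coord 1 ^ b

theorem raising_pow_coord (i : Fin 2) (n : ℕ) : raising (coord i ^ n) = 0 := by
  induction n with
  | zero =>
    have h := raising_mul 1 1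
    simpa using h
  | succ n ih => rw [pow_succ, raising_mul, ih, raising_coord, zero_mul, mul_zero, add_zero]

theorem raising_mono (a b : ℕ) : raising (mono a b) = 0 := by
  rw [mono, raising_mul, raising_pow_coord, raising_pow_coord, zero_mul, mul_zero, add_zero]

theorem mono_apply (a b : ℕ) (g : S3) : (mono a b).1 g = g.1 0 ^ a * g.1 1 ^ b := rfl

theorem mono_mem_weight (a b : ℕ) : mono a b ∈ weight (a + b) := by
  intro θ g
  rw [mono_apply, mono_apply]
  change (Complex.exp (θ * Complex.I) * g.1 0) ^ a * (Complex.exp (θ * Complex.I) * g.1 1) ^ b = _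
  have : Complex.exp (((a + b : ℤ) : ℂ) * θ * Complex.I) =
      Complex.exp (θ * Complex.I) ^ a * Complex.exp (θ * Complex.I) ^ b := by
    rw [← pow_add, ← Complex.exp_nat_mul]
    congr 1
    push_cast
    ring
  rw [this]
  ring

theorem mono_ne_zero (a b : ℕ) : mono a b ≠ 0 := by
  intro h
  have hs : ((√2)⁻¹ : ℝ) ≠ 0 := by positivity
  let g : S3 := ⟨!₂[((√2)⁻¹ : ℝ), ((√2)⁻¹ : ℝ)], by
    rw [mem_sphere_iff_norm, sub_zero, EuclideanSpace.norm_eq, Fin.sum_univ_two]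
    simp
    norm_num⟩
  have h1 : (mono a b).1 g = 0 := congrArg (fun u : Smooth => u.1 g) h
  have h2 : (((√2)⁻¹ : ℝ) : ℂ) ^ a * (((√2)⁻¹ : ℝ) : ℂ) ^ b = 0 := h1
  simp at h2

/-! ### Ladders of eigenfunctions -/

/-- The functions obtained from holomorphic monomials by applying the lowering operator `j` times. -/
def ladder (j a b : ℕ) : Smooth := (lowering ^ j) (mono a b)

theorem ladder_zero (a b : ℕ) : ladder 0 a b = mono a b := rfl

theorem ladder_succ (j a b : ℕ) : ladder (j + 1) a b = lowering (ladder j a b) := by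
  rw [ladder, pow_succ', Module.End.mul_apply]
  rfl

theorem ladder_succ_of_lowering_mono (j a b : ℕ) :
    ladder (j + 1) a b = (lowering ^ j) (lowering (mono a b)) := by
  rw [ladder, pow_succ, Module.End.mul_apply]

theorem ladder_mem_weight (j a b : ℕ) : ladder j a b ∈ weight (a + b - 2 * j) := by
  induction j with
  | zero => simpa [ladder_zero] using mono_mem_weight a b
  | succ j ih =>
    rw [ladder_succ]
    have := lowering_mem_weight ih
    convert this using 2
    push_cast
    ring

/-- The usual `sl₂` induction: each step adds minus the current weight `a+b-2j`, and these sum to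
`-j(a+b-j+1)`. -/
theorem lowering_raising_ladder (j a b : ℕ) :
    lowering (raising (ladder j a b)) = (-(j * (a + b - j + 1)) : ℂ) • ladder j a b := by
  induction j with
  | zero => simp [ladder_zero, raising_mono]
  | succ j ih =>
    have h := lowering_raising_sub (ladder_mem_weight j a b)
    have h2 : raising (lowering (ladder j a b)) =
        (-(j * (a + b - j + 1)) : ℂ) • ladder j a b
          - (((a + b - 2 * j : ℤ)) : ℂ) • ladder j a b := by
      rw [← h, ← ih]
      abel
    rw [ladder_succ, h2, map_sub, map_smul, map_smul]
    push_cast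
    module

theorem raising_ladder_succ (j a b : ℕ) :
    raising (ladder (j + 1) a b) = (-((j + 1) * (a + b - j)) : ℂ) • ladder j a b := by
  have h := lowering_raising_sub (ladder_mem_weight j a b)
  rw [lowering_raising_ladder] at h
  rw [ladder_succ]
  have h2 : raising (lowering (ladder j a b)) =
        (-(j * (a + b - j + 1)) : ℂ) • ladder j a b
          - (((a + b - 2 * j : ℤ)) : ℂ) • ladder j a b := by
    rw [← h]
    abel
  rw [h2]
  push_cast
  module

/-- Each `lowering` is moved across as `-raising`, which descends the left ladder by one rung and
leaves a scalar. Keeping `v` arbitrary serves both the nonvanishing and the orthogonality of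
ladders. -/
theorem inner_ladder_ladder (j a b : ℕ) (v : Smooth) :
    inner ℂ (smoothToL2 (ladder j a b)) (smoothToL2 ((lowering ^ j) v)) =
      (∏ i ∈ Finset.range j, ((i + 1) * (a + b - i) : ℂ)) *
        inner ℂ (smoothToL2 (mono a b)) (smoothToL2 v) := by
  induction j with
  | zero => simp [ladder_zero]
  | succ j ih =>
    rw [pow_succ', Module.End.mul_apply, inner_lowering, raising_ladder_succ, map_smul,
      inner_smul_left, ih, Finset.prod_range_succ]
    simp only [map_neg, map_mul, map_add, map_sub, map_natCast, map_one]
    ring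

theorem ladder_ne_zero {j a b : ℕ} (h : j ≤ a + b) : ladder j a b ≠ 0 := by
  intro h0
  have h1 := inner_ladder_ladder j a b (mono a b)
  rw [h0, map_zero, inner_zero_left, eq_comm, mul_eq_zero] at h1
  rcases h1 with h1 | h1
  · rw [Finset.prod_eq_zero_iff] at h1
    obtain ⟨i, hi, h2⟩ := h1
    rw [Finset.mem_range] at hi
    rcases mul_eq_zero.1 h2 with h3 | h3
    · exact Nat.cast_add_one_ne_zero i h3
    · rw [sub_eq_zero] at h3
      have : a + b = i := by exact_mod_cast h3
      omega
  · rw [inner_self_eq_zero] at h1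
    exact mono_ne_zero a b (smoothToL2_injective (by rw [h1, map_zero]))

theorem inner_mono_mono {a b a' b' : ℕ} (h : a ≠ a') :
    inner ℂ (smoothToL2 (mono a b)) (smoothToL2 (mono a' b')) = 0 := by
  rw [inner_smoothToL2]
  have hne : ((a' : ℝ) - a) ≠ 0 := sub_ne_zero.2 (by exact_mod_cast h.symm)
  have hne' : ((a' : ℂ) - a) ≠ 0 := sub_ne_zero.2 (by exact_mod_cast h.symm)
  set θ : ℝ := Real.pi / ((a' : ℝ) - a) with hθ
  refine integral_eq_zero_of_comp (measurePreserving_torus (Circle.exp θ)) _ (a := -1)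
    (by norm_num) fun g => ?_
  change (starRingEnd ℂ) ((Circle.exp θ * g.1 0) ^ a * g.1 1 ^ b)
    * ((Circle.exp θ * g.1 0) ^ a' * g.1 1 ^ b') =
    -1 * ((starRingEnd ℂ) (g.1 0 ^ a * g.1 1 ^ b) * (g.1 0 ^ a' * g.1 1 ^ b'))
  have e : (starRingEnd ℂ) (Circle.exp θ : ℂ) ^ a * (Circle.exp θ : ℂ) ^ a' = -1 := by
    rw [Circle.coe_exp, ← Complex.exp_conj, ← Complex.exp_nat_mul, ← Complex.exp_nat_mul,
      ← Complex.exp_add, ← Complex.exp_pi_mul_I]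
    congr 1
    simp only [map_mul, Complex.conj_I, Complex.conj_ofReal]
    have : (θ : ℂ) * ((a' : ℂ) - a) = Real.pi := by
      rw [hθ]
      push_cast
      field_simp
    linear_combination Complex.I * this
  simp only [map_mul, map_pow, mul_pow]
  linear_combination ((starRingEnd ℂ) (g.1 0) ^ a * (starRingEnd ℂ) (g.1 1) ^ b
    * (g.1 0 ^ a' * g.1 1 ^ b')) * e

theorem inner_ladder_eq_zero {j a b a' b' : ℕ} (h : a ≠ a') :
    inner ℂ (smoothToL2 (ladder j a b)) (smoothToL2 (ladder j a' b')) = 0 := by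
  rw [ladder.eq_1 j a' b', inner_ladder_ladder, inner_mono_mono h, mul_zero]

/-! ### Completeness -/

theorem lowering_pow_conj_coord_mul (i : Fin 2) (j : ℕ) (v : Smooth) :
    (lowering ^ j) (conj (coord i) * v) = conj (coord i) * (lowering ^ j) v := by
  induction j with
  | zero => rfl
  | succ j ih =>
    rw [pow_succ', Module.End.mul_apply, ih, lowering_mul, lowering_conj_coord, zero_mul, zero_add,
      Module.End.mul_apply]

/-- The Leibniz rule stops after two terms, because `lowering` sends `coord 0` to `-conj (coord 1)`
and kills the latter. -/
theorem lowering_pow_coord_zero_mul (j : ℕ) (v : Smooth) :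
    (lowering ^ (j + 1)) (coord 0 * v) = coord 0 * (lowering ^ (j + 1)) v
      - ((j : ℂ) + 1) • (conj (coord 1) * (lowering ^ j) v) := by
  induction j with
  | zero =>
    simp only [zero_add, pow_one, pow_zero, Module.End.one_apply, lowering_mul, lowering_coord_zero,
      smul_mul_assoc, Nat.cast_zero]
    module
  | succ j ih =>
    rw [pow_succ', Module.End.mul_apply, ih, map_sub, map_smul, lowering_mul, lowering_mul,
      lowering_conj_coord, lowering_coord_zero, ← Module.End.mul_apply, ← Module.End.mul_apply,
      ← pow_succ', ← pow_succ', zero_mul, zero_add, smul_mul_assoc]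
    push_cast
    module

theorem lowering_pow_coord_one_mul (j : ℕ) (v : Smooth) :
    (lowering ^ (j + 1)) (coord 1 * v) = coord 1 * (lowering ^ (j + 1)) v
      + ((j : ℂ) + 1) • (conj (coord 0) * (lowering ^ j) v) := by
  induction j with
  | zero =>
    simp [lowering_mul, lowering_coord_one]
    abel
  | succ j ih =>
    rw [pow_succ', Module.End.mul_apply, ih, map_add, map_smul, lowering_mul, lowering_mul,
      lowering_conj_coord, lowering_coord_one, ← Module.End.mul_apply, ← Module.End.mul_apply,
      ← pow_succ', ← pow_succ', zero_mul, zero_add]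
    push_cast
    module

theorem coord_zero_mul_mono (a b : ℕ) : coord 0 * mono a b = mono (a + 1) b := by
  rw [mono, mono, pow_succ]
  ring

theorem coord_one_mul_mono (a b : ℕ) : coord 1 * mono a b = mono a (b + 1) := by
  rw [mono, mono, pow_succ]
  ring

/-- Expand `lowering (mono (a+1) b)` and replace `z z̄` by `1 - w w̄`. At `b = 0` the truncated
exponent `b - 1` is harmless, its coefficient being zero. -/
theorem conj_coord_one_mul_mono (a b : ℕ) :
    ((a : ℂ) + b + 1) • (conj (coord 1) * mono a b) =
      (b : ℂ) • mono a (b - 1) - lowering (mono (a + 1) b) := by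
  have hs := coord_mul_conj_add
  cases b with
  | zero =>
    simp only [mono, pow_zero, mul_one, lowering_pow, lowering_coord_zero, Nat.cast_zero, zero_smul,
      add_zero, zero_sub, mul_smul_comm]
    rw [mul_comm]
    module
  | succ b =>
    have e : coord 0 ^ (a + 1) * (coord 1 ^ b * conj (coord 0)) =
        mono a b - conj (coord 1) * mono a (b + 1) := by
      rw [mono, mono, pow_succ, pow_succ]
      linear_combination (coord 0 ^ a * coord 1 ^ b) * hs
    have e2 : coord 0 ^ a * conj (coord 1) * coord 1 ^ (b + 1) =
        conj (coord 1) * mono a (b + 1) := by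
      rw [mono]
      ring
    rw [mono.eq_1 (a + 1), lowering_mul, lowering_pow, lowering_pow, lowering_coord_zero,
      lowering_coord_one, mul_smul_comm, mul_smul_comm, smul_mul_assoc, smul_mul_assoc, e, e2,
      Nat.add_sub_cancel]
    push_cast
    module

theorem conj_coord_zero_mul_mono (a b : ℕ) :
    ((a : ℂ) + b + 1) • (conj (coord 0) * mono a b) =
      (a : ℂ) • mono (a - 1) b + lowering (mono a (b + 1)) := by
  have hs := coord_mul_conj_add
  cases a with
  | zero =>
    simp only [mono, pow_zero, one_mul, lowering_pow, lowering_coord_one, Nat.cast_zero, zero_smul,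
      zero_add]
    rw [mul_comm]
  | succ a =>
    have e : coord 0 ^ a * conj (coord 1) * coord 1 ^ (b + 1) =
        mono a b - conj (coord 0) * mono (a + 1) b := by
      rw [mono, mono, pow_succ, pow_succ]
      linear_combination (coord 0 ^ a * coord 1 ^ b) * hs
    have e2 : coord 0 ^ (a + 1) * (coord 1 ^ b * conj (coord 0)) =
        conj (coord 0) * mono (a + 1) b := by
      rw [mono]
      ring
    rw [mono.eq_1 _ (b + 1), lowering_mul, lowering_pow, lowering_pow, lowering_coord_zero,
      lowering_coord_one, mul_smul_comm, mul_smul_comm, smul_mul_assoc, smul_mul_assoc, e, e2,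
      Nat.add_sub_cancel]
    push_cast
    module

/-- The span of all ladders. -/
def ladderSpan : Submodule ℂ Smooth :=
  Submodule.span ℂ (Set.range fun p : ℕ × ℕ × ℕ => ladder p.1 p.2.1 p.2.2)

theorem ladder_mem_ladderSpan (j a b : ℕ) : ladder j a b ∈ ladderSpan :=
  Submodule.subset_span ⟨(j, a, b), rfl⟩

theorem add_add_one_ne_zero (a b : ℕ) : (a : ℂ) + b + 1 ≠ 0 := by
  exact_mod_cast Nat.succ_ne_zero (a + b)

/-- Multiplication by `conj (coord 1)` commutes with `lowering`, so the identity for monomials can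
be lowered `j` times. Division by `a+b+1` is legitimate because it never vanishes. -/
theorem conj_coord_one_mul_ladder (j a b : ℕ) :
    conj (coord 1) * ladder j a b ∈ ladderSpan := by
  rw [← ladderSpan.smul_mem_iff (add_add_one_ne_zero a b), ladder, ← lowering_pow_conj_coord_mul,
    ← map_smul, conj_coord_one_mul_mono, map_sub, map_smul, ← ladder_succ_of_lowering_mono]
  exact ladderSpan.sub_mem (ladderSpan.smul_mem _ (ladder_mem_ladderSpan _ _ _))
    (ladder_mem_ladderSpan _ _ _)

theorem conj_coord_zero_mul_ladder (j a b : ℕ) :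
    conj (coord 0) * ladder j a b ∈ ladderSpan := by
  rw [← ladderSpan.smul_mem_iff (add_add_one_ne_zero a b), ladder, ← lowering_pow_conj_coord_mul,
    ← map_smul, conj_coord_zero_mul_mono, map_add, map_smul, ← ladder_succ_of_lowering_mono]
  exact ladderSpan.add_mem (ladderSpan.smul_mem _ (ladder_mem_ladderSpan _ _ _))
    (ladder_mem_ladderSpan _ _ _)

/-- For a positive number of lowerings, the Leibniz formula expresses the product by a ladder and a
conjugate coordinate times a shorter ladder, which is already covered. -/
theorem coord_zero_mul_ladder (j a b : ℕ) : coord 0 * ladder j a b ∈ ladderSpan := by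
  cases j with
  | zero =>
    rw [ladder_zero, coord_zero_mul_mono]
    exact ladder_mem_ladderSpan 0 _ _
  | succ j =>
    have h := lowering_pow_coord_zero_mul j (mono a b)
    rw [coord_zero_mul_mono, eq_sub_iff_add_eq] at h
    rw [ladder, ← h]
    exact ladderSpan.add_mem (ladder_mem_ladderSpan _ _ _)
      (ladderSpan.smul_mem _ (conj_coord_one_mul_ladder _ _ _))

theorem coord_one_mul_ladder (j a b : ℕ) : coord 1 * ladder j a b ∈ ladderSpan := by
  cases j with
  | zero =>
    rw [ladder_zero, coord_one_mul_mono]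
    exact ladder_mem_ladderSpan 0 _ _
  | succ j =>
    have h := lowering_pow_coord_one_mul j (mono a b)
    rw [coord_one_mul_mono, ← sub_eq_iff_eq_add] at h
    rw [ladder, ← h]
    exact ladderSpan.sub_mem (ladder_mem_ladderSpan _ _ _)
      (ladderSpan.smul_mem _ (conj_coord_zero_mul_ladder _ _ _))

/-- The algebra of multipliers of the span of all ladders. -/
def multipliers : Subalgebra ℂ Smooth where
  carrier := {x | ∀ v ∈ ladderSpan, x * v ∈ ladderSpan}
  add_mem' := fun hx hy v hv => by
    rw [add_mul]
    exact ladderSpan.add_mem (hx v hv) (hy v hv)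
  mul_mem' := fun hx hy v hv => by
    rw [mul_assoc]
    exact hx _ (hy v hv)
  algebraMap_mem' := fun c v hv => by
    rw [← Algebra.smul_def]
    exact ladderSpan.smul_mem c hv

theorem mem_multipliers {x : Smooth} (h : ∀ j a b, x * ladder j a b ∈ ladderSpan) :
    x ∈ multipliers := by
  intro v hv
  have : ladderSpan ≤ ladderSpan.comap (LinearMap.mulLeft ℂ x) := by
    refine Submodule.span_le.2 ?_
    rintro _ ⟨⟨j, a, b⟩, rfl⟩
    exact h j a b
  exact this hv

theorem multipliers_le : ∀ x ∈ multipliers, x ∈ ladderSpan := by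
  intro x hx
  have h1 : (1 : Smooth) ∈ ladderSpan := by
    have := ladder_mem_ladderSpan 0 0 0
    simpa [ladder_zero, mono] using this
  simpa using hx 1 h1

/-- A smooth function as a continuous map. -/
def smoothToContinuous : Smooth →ₐ[ℂ] C(S3, ℂ) where
  toFun u := ⟨u.1, Smooth.continuous u⟩
  map_one' := rfl
  map_mul' _ _ := rfl
  map_zero' := rfl
  map_add' _ _ := rfl
  commutes' _ := rfl

/-- Stone-Weierstrass applies to the star algebra generated by the two coordinates, which separate
points. That algebra lies in the image of `multipliers`, since both the coordinates and their
conjugates preserve `ladderSpan`. -/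
theorem dense_map_multipliers :
    Dense (multipliers.map smoothToContinuous : Set C(S3, ℂ)) := by
  let A : StarSubalgebra ℂ C(S3, ℂ) :=
    StarAlgebra.adjoin ℂ (Set.range fun i => smoothToContinuous (coord i))
  have hA : A.topologicalClosure = ⊤ := by
    refine ContinuousMap.starSubalgebra_topologicalClosure_eq_top_of_separatesPoints A ?_
    intro g g' hne
    by_contra hcon
    apply hne
    apply Subtype.ext
    ext i
    by_contra hi
    exact hcon ⟨_, ⟨smoothToContinuous (coord i),
      StarAlgebra.subset_adjoin ℂ _ ⟨i, rfl⟩, rfl⟩, hi⟩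
  have hle : A.toSubalgebra ≤ multipliers.map smoothToContinuous := by
    change (StarAlgebra.adjoin ℂ _).toSubalgebra ≤ _
    rw [StarAlgebra.adjoin_toSubalgebra]
    refine Algebra.adjoin_le ?_
    rintro f (⟨i, rfl⟩ | hf)
    · refine ⟨coord i, mem_multipliers ?_, rfl⟩
      fin_cases i
      exacts [coord_zero_mul_ladder, coord_one_mul_ladder]
    · obtain ⟨i, hi⟩ := hf
      refine ⟨conj (coord i), mem_multipliers ?_, ?_⟩
      · fin_cases i
        exacts [conj_coord_zero_mul_ladder, conj_coord_one_mul_ladder]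
      · rw [← star_star f, ← hi]
        rfl
  have hd : Dense (A : Set C(S3, ℂ)) := by
    rw [dense_iff_closure_eq]
    have := congrArg (fun B : StarSubalgebra ℂ C(S3, ℂ) => (B : Set C(S3, ℂ))) hA
    simpa using this
  exact hd.mono hle

theorem eq_zero_of_inner_ladder {x : Lp ℂ 2 hopfMeasure}
    (hx : ∀ j a b, inner ℂ (smoothToL2 (ladder j a b)) x = 0) : x = 0 := by
  have h1 : ∀ u ∈ ladderSpan, inner ℂ (smoothToL2 u) x = 0 := by
    intro u hu
    induction hu using Submodule.span_induction with
    | mem u hu =>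
      obtain ⟨⟨j, a, b⟩, rfl⟩ := hu
      exact hx j a b
    | zero => simp
    | add u v _ _ hu hv => rw [map_add, inner_add_left, hu, hv, add_zero]
    | smul c u _ hu => rw [map_smul, inner_smul_left, hu, mul_zero]
  have hcl : IsClosed {y : Lp ℂ 2 hopfMeasure | inner ℂ y x = 0} :=
    isClosed_eq (continuous_id.inner continuous_const) continuous_const
  have h2 : ∀ f : C(S3, ℂ), inner ℂ (ContinuousMap.toLp 2 hopfMeasure ℂ f) x = 0 := by
    intro f
    have hcl' := hcl.preimage (ContinuousMap.toLp 2 hopfMeasure ℂ : C(S3, ℂ) →L[ℂ] _).continuous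
    refine hcl'.closure_subset_iff.2 ?_ (dense_map_multipliers f)
    rintro _ ⟨u, hu, rfl⟩
    exact h1 u (multipliers_le u hu)
  have hd : DenseRange (ContinuousMap.toLp 2 hopfMeasure ℂ : C(S3, ℂ) →L[ℂ] Lp ℂ 2 hopfMeasure) :=
    ContinuousMap.toLp_denseRange ℂ hopfMeasure ℂ (by norm_num)
  have h3 : inner ℂ x x = 0 := by
    refine hcl.closure_subset_iff.2 ?_ (hd x)
    rintro _ ⟨f, rfl⟩
    exact h2 f
  exact inner_self_eq_zero.1 h3

/-! ### Diagonal operators in a Hilbert basis -/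

section Diagonal

variable {ι H : Type} [NormedAddCommGroup H] [InnerProductSpace ℂ H]

theorem hasSum_sq_repr (b : HilbertBasis ι ℂ H) (x : H) :
    HasSum (fun n => ‖b.repr x n‖ ^ 2) (‖x‖ ^ 2) := by
  have h := b.hasSum_inner_mul_inner x x
  rw [inner_self_eq_norm_sq_to_K] at h
  rw [← Complex.hasSum_ofReal]
  rw [Complex.ofReal_pow]
  refine h.congr_fun fun n => ?_
  rw [b.repr_apply_apply, ← inner_conj_symm x (b n), mul_comm, RCLike.mul_conj]
  simp

/-- Parseval and dominated convergence in `ℓ²`. Both strong continuity and the derivative at `0` of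
the semigroup reduce to this. -/
theorem tendsto_zero_of_repr {α : Type*} {k : Filter α} (b : HilbertBasis ι ℂ H) {f : α → H}
    {bound : ι → ℝ} (hb : Summable fun n => bound n ^ 2)
    (h1 : ∀ n, Tendsto (fun a => b.repr (f a) n) k (𝓝 0))
    (h2 : ∀ᶠ a in k, ∀ n, ‖b.repr (f a) n‖ ≤ bound n) : Tendsto f k (𝓝 0) := by
  have h3 : Tendsto (fun a => ∑' n, ‖b.repr (f a) n‖ ^ 2) k (𝓝 (∑' _ : ι, (0 : ℝ))) := by
    refine tendsto_tsum_of_dominated_convergence hb (fun n => ?_) ?_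
    · simpa using ((h1 n).norm.pow 2)
    · filter_upwards [h2] with a ha n
      rw [norm_pow, norm_norm]
      exact pow_le_pow_left₀ (norm_nonneg _) (ha n) 2
  rw [tsum_zero] at h3
  rw [tendsto_zero_iff_norm_tendsto_zero]
  have h4 : Tendsto (fun a => √(∑' n, ‖b.repr (f a) n‖ ^ 2)) k (𝓝 0) := by
    simpa using h3.sqrt
  refine h4.congr fun a => ?_
  rw [(hasSum_sq_repr b (f a)).tsum_eq, Real.sqrt_sq (norm_nonneg _)]

theorem memℓp_diag {c : ι → ℂ} {M : ℝ} (hc : ∀ n, ‖c n‖ ≤ M) (b : HilbertBasis ι ℂ H) (x : H) :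
    Memℓp (fun n => c n * b.repr x n) 2 := by
  refine memℓp_gen ?_
  refine Summable.of_nonneg_of_le (fun n => by positivity) (fun n => ?_)
    ((hasSum_sq_repr b x).summable.mul_left (M ^ 2))
  simp only [ENNReal.toReal_ofNat, Real.rpow_ofNat]
  rw [norm_mul, mul_pow]
  gcongr
  exact hc n

/-- The bounded operator with eigenvectors `b n` and eigenvalues `c n`. -/
def diagOp (b : HilbertBasis ι ℂ H) (c : ι → ℂ) (M : ℝ) (hc : ∀ n, ‖c n‖ ≤ M) : H →L[ℂ] H :=
  LinearMap.mkContinuous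
    { toFun := fun x => b.repr.symm ⟨fun n => c n * b.repr x n, memℓp_diag hc b x⟩
      map_add' := fun x y => by
        rw [← map_add]
        congr 1
        ext n
        change c n * b.repr (x + y) n = c n * b.repr x n + c n * b.repr y n
        rw [map_add]
        exact mul_add _ _ _
      map_smul' := fun r x => by
        rw [← map_smul]
        congr 1
        ext n
        simp [mul_left_comm] } |M| fun x => by
    -- The bound is `|M|`, since for an empty index type the hypothesis does not force `M ≥ 0`.
    refine le_of_sq_le_sq ?_ (by positivity)
    have h := hasSum_sq_repr b (b.repr.symm ⟨fun n => c n * b.repr x n, memℓp_diag hc b x⟩)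
    rw [mul_pow, sq_abs]
    refine hasSum_le (fun n => ?_) h ((hasSum_sq_repr b x).mul_left (M ^ 2))
    rw [LinearIsometryEquiv.apply_symm_apply]
    change ‖c n * b.repr x n‖ ^ 2 ≤ _
    rw [norm_mul, mul_pow]
    gcongr
    exact hc n

theorem repr_diagOp (b : HilbertBasis ι ℂ H) (c : ι → ℂ) (M : ℝ) (hc : ∀ n, ‖c n‖ ≤ M) (x : H)
    (n : ι) : b.repr (diagOp b c M hc x) n = c n * b.repr x n := by
  change b.repr (b.repr.symm ⟨fun n => c n * b.repr x n, memℓp_diag hc b x⟩) n = _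
  rw [LinearIsometryEquiv.apply_symm_apply]

theorem eq_of_repr_eq (b : HilbertBasis ι ℂ H) {x y : H} (h : ∀ n, b.repr x n = b.repr y n) :
    x = y :=
  b.repr.injective (lp.ext (funext h))

/-! ### Heat semigroups with a basis of eigenvectors -/

theorem norm_exp_neg_le {C s t lam : ℝ} (hC : 0 ≤ C) (hlam : -C ≤ lam) (hs : 0 ≤ s) (hst : s ≤ t) :
    ‖Complex.exp (-(s * lam : ℝ))‖ ≤ Real.exp (t * C) := by
  rw [← Complex.ofReal_neg, Complex.norm_exp_ofReal]
  refine Real.exp_le_exp.2 ?_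
  nlinarith

theorem abs_exp_sub_one_le {y c : ℝ} (hc : 0 ≤ c) (hy : y ≤ c) :
    |Real.exp y - 1| ≤ |y| * Real.exp c := by
  rcases le_total 0 y with h | h
  · rw [abs_of_nonneg (by linarith [Real.add_one_le_exp y]), abs_of_nonneg h]
    have h1 := Real.add_one_le_exp (-y)
    have h2 : Real.exp y * Real.exp (-y) = 1 := by rw [← Real.exp_add]; simp
    have h3 : Real.exp y - 1 ≤ y * Real.exp y := by nlinarith [Real.exp_pos y]
    exact h3.trans (mul_le_mul_of_nonneg_left (Real.exp_le_exp.2 hy) h)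
  · have h1 : Real.exp y ≤ 1 := Real.exp_le_one_iff.2 h
    rw [abs_of_nonpos (by linarith), abs_of_nonpos h]
    have h2 := Real.add_one_le_exp y
    have h3 : 1 ≤ Real.exp c := Real.one_le_exp hc
    nlinarith

variable {V : Type*} [AddCommGroup V] [Module ℂ V]

theorem exists_isHeatSemigroup (i : V →ₗ[ℂ] H) (A : Module.End ℂ V) (b : HilbertBasis ι ℂ H)
    {lam : ι → ℝ} {C : ℝ} (hC : 0 ≤ C) (hlam : ∀ n, -C ≤ lam n)
    (hA : ∀ n v, b.repr (i (A v)) n = lam n * b.repr (i v) n) :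
    ∃ S, IsHeatSemigroup i A S := by
  -- Times are truncated at `0`: for negative `t` the factors `e^{-tλ}` may be unbounded, and
  -- `IsHeatSemigroup` does not constrain those times.
  let S : ℝ → H →L[ℂ] H := fun t => diagOp b (fun n => Complex.exp (-(max t 0 * lam n : ℝ)))
    (Real.exp (max t 0 * C)) fun n => norm_exp_neg_le hC (hlam n) (le_max_right _ _) le_rfl
  have hS : ∀ t x n, b.repr (S t x) n = Complex.exp (-(max t 0 * lam n : ℝ)) * b.repr x n :=
    fun t x n => repr_diagOp b _ _ _ x n
  have hS0 : S 0 = 1 := by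
    ext x
    refine eq_of_repr_eq b fun n => ?_
    rw [hS]
    simp
  refine ⟨S, hS0, ?_, ?_, ?_⟩
  · intro s t hs ht
    ext x
    refine eq_of_repr_eq b fun n => ?_
    rw [mul_apply_eq_comp, hS, hS, hS, ← mul_assoc, ← Complex.exp_add,
      max_eq_left hs, max_eq_left ht, max_eq_left (add_nonneg hs ht)]
    congr 2
    push_cast
    ring
  · intro x
    refine Continuous.continuousOn (continuous_iff_continuousAt.2 fun t₀ => ?_)
    rw [ContinuousAt, ← tendsto_sub_nhds_zero_iff]
    set T := max t₀ 0 + 1 with hT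
    refine tendsto_zero_of_repr b (bound := fun n => 2 * Real.exp (T * C) * ‖b.repr x n‖) ?_ ?_ ?_
    · simp only [mul_pow]
      exact (hasSum_sq_repr b x).summable.mul_left _
    · intro n
      simp only [map_sub, lp.coeFn_sub, Pi.sub_apply, hS]
      rw [tendsto_sub_nhds_zero_iff]
      have : Continuous fun t : ℝ => Complex.exp (-(max t 0 * lam n : ℝ)) * b.repr x n := by
        fun_prop
      exact this.tendsto t₀
    · filter_upwards [Iio_mem_nhds (show t₀ < t₀ + 1 by linarith)] with t ht n
      simp only [map_sub, lp.coeFn_sub, Pi.sub_apply, hS]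
      rw [← sub_mul, norm_mul]
      refine mul_le_mul_of_nonneg_right ?_ (norm_nonneg _)
      rw [two_mul]
      refine (norm_sub_le _ _).trans (add_le_add ?_ ?_)
      · refine norm_exp_neg_le hC (hlam n) (le_max_right _ _) ?_
        rw [hT, max_le_iff]
        rw [Set.mem_Iio] at ht
        constructor <;> linarith [le_max_left t₀ 0, le_max_right t₀ 0]
      · exact norm_exp_neg_le hC (hlam n) (le_max_right _ _) (by linarith)
  · intro v
    rw [hasDerivWithinAt_iff_tendsto_slope, Set.Ici_sdiff_left, ← tendsto_sub_nhds_zero_iff]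
    have hcoord : ∀ t : ℝ, 0 < t → ∀ n, b.repr (slope (fun t => S t (i v)) 0 t - -i (A v)) n =
        ((t⁻¹ * (Real.exp (-(t * lam n)) - 1) + lam n : ℝ) : ℂ) * b.repr (i v) n := by
      intro t ht n
      rw [slope_def_module, hS0, ← Complex.coe_smul]
      simp only [map_sub, map_neg, map_smul, lp.coeFn_sub, lp.coeFn_neg, lp.coeFn_smul,
        Pi.sub_apply, Pi.neg_apply, Pi.smul_apply, hS, hA, one_apply_eq_self,
        max_eq_left ht.le, smul_eq_mul]
      push_cast
      ring
    -- For `0 < t < 1` the difference quotient of `e^{-tλ}` is at most `|λ| e^C`, and `λ` times the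
    -- coefficient of `i v` is the coefficient of `i (A v)`. The bound is therefore square summable.
    refine tendsto_zero_of_repr b
      (bound := fun n => (Real.exp C + 1) * ‖b.repr (i (A v)) n‖) ?_ ?_ ?_
    · simp only [mul_pow]
      exact (hasSum_sq_repr b _).summable.mul_left _
    · intro n
      have h1 : HasDerivAt (fun t : ℝ => Real.exp (-(t * lam n))) (-lam n) 0 := by
        have := ((hasDerivAt_id (0 : ℝ)).mul_const (lam n)).neg.exp
        simpa using this
      have h2 := (hasDerivAt_iff_tendsto_slope.1 h1).mono_left
        (nhdsWithin_mono 0 (fun t ht => (Set.mem_Ioi.1 ht).ne' : Set.Ioi (0 : ℝ) ⊆ {0}ᶜ))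
      have h3 : Tendsto (fun t => ((slope (fun t : ℝ => Real.exp (-(t * lam n))) 0 t + lam n : ℝ) : ℂ)
          * b.repr (i v) n) (𝓝[>] 0) (𝓝 0) := by
        have := (Complex.continuous_ofReal.tendsto _).comp (h2.add_const (lam n))
        simpa [Function.comp_def] using this.mul_const (b.repr (i v) n)
      refine h3.congr' ?_
      filter_upwards [self_mem_nhdsWithin] with t ht
      rw [hcoord t ht, slope_def_field]
      congr 2
      simp
      ring
    · filter_upwards [Ioo_mem_nhdsGT (show (0 : ℝ) < 1 by norm_num)] with t ht n
      rw [hcoord t ht.1, hA, norm_mul, norm_mul, ← mul_assoc]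
      refine mul_le_mul_of_nonneg_right ?_ (norm_nonneg _)
      rw [Complex.norm_real, Complex.norm_real, Real.norm_eq_abs, Real.norm_eq_abs, add_mul, one_mul]
      refine (abs_add_le _ _).trans (add_le_add ?_ le_rfl)
      have ht0 := ht.1
      rw [abs_mul, abs_of_pos (inv_pos.2 ht0), inv_mul_le_iff₀ ht0]
      have := abs_exp_sub_one_le (y := -(t * lam n)) hC (by nlinarith [hlam n, ht.1, ht.2])
      rw [abs_neg, abs_mul, abs_of_pos ht0] at this
      linarith

/-- The semigroup law transports the right derivative from `0` to every `s`. Thus `e^{rλ} S_r (i v)`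
is continuous with zero right derivative, hence constant. This pins down the trace of any heat
semigroup without a general uniqueness theorem. -/
theorem IsHeatSemigroup.apply_eigenvector {i : V →ₗ[ℂ] H} {A : Module.End ℂ V} {S : ℝ → H →L[ℂ] H}
    (hS : IsHeatSemigroup i A S) {v : V} {lam : ℝ} (hv : A v = (lam : ℂ) • v) {t : ℝ} (ht : 0 ≤ t) :
    S t (i v) = (Real.exp (-t * lam) : ℂ) • i v := by
  have hd : ∀ s, 0 ≤ s → HasDerivWithinAt (fun r => S r (i v)) (-(lam : ℂ) • S s (i v))
      (Set.Ici s) s := by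
    intro s hs
    have h0 := hS.deriv v
    rw [hv, map_smul] at h0
    have h1 : HasDerivWithinAt (fun r => S (r - s) (i v)) (-((lam : ℂ) • i v)) (Set.Ici s) s := by
      have hsub : HasDerivWithinAt (fun r : ℝ => r - s) 1 (Set.Ici s) s :=
        ((hasDerivAt_id s).sub_const s).hasDerivWithinAt
      have h0' : HasDerivWithinAt (fun t => S t (i v)) (-((lam : ℂ) • i v)) (Set.Ici 0)
          ((fun r : ℝ => r - s) s) := by simpa using h0
      have := HasDerivWithinAt.scomp (h := fun r : ℝ => r - s) s h0' hsub
        (fun r (hr : s ≤ r) => sub_nonneg.2 hr)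
      simpa [Function.comp_def] using this
    have h2 := ((S s).restrictScalars ℝ).hasFDerivAt.comp_hasDerivWithinAt s h1
    have h3 : HasDerivWithinAt (fun r => S s (S (r - s) (i v))) (-(lam : ℂ) • S s (i v))
        (Set.Ici s) s := by
      simpa [Function.comp_def] using h2
    refine h3.congr_of_mem (fun r hr => ?_) Set.self_mem_Ici
    have := hS.add s (r - s) hs (sub_nonneg.2 hr)
    rw [add_sub_cancel] at this
    rw [this]
    rfl
  have he : ∀ s : ℝ, HasDerivAt (fun r : ℝ => (Real.exp (r * lam) : ℂ))
      ((Real.exp (s * lam) * lam : ℝ) : ℂ) s := fun s => by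
    have := ((hasDerivAt_id s).mul_const lam).exp.ofReal_comp
    simpa using this
  have hconst := constant_of_has_deriv_right_zero
    (f := fun r => (Real.exp (r * lam) : ℂ) • S r (i v)) (a := 0) (b := t) ?_ ?_ t ⟨ht, le_rfl⟩
  · simp only [zero_mul, Real.exp_zero, Complex.ofReal_one, one_smul, hS.zero,
      one_apply_eq_self] at hconst
    conv_rhs => rw [← hconst, smul_smul, ← Complex.ofReal_mul, ← Real.exp_add]
    simp
  · refine ContinuousOn.smul ?_ ((hS.cont (i v)).mono fun r hr => hr.1)
    exact fun r _ => (he r).continuousAt.continuousWithinAt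
  · intro s hs
    have := (he s).hasDerivWithinAt.smul (hd s hs.1)
    refine this.congr_deriv ?_
    rw [smul_smul, ← add_smul]
    convert zero_smul ℂ _
    push_cast
    ring

/-! ### Traces of diagonal operators -/

/-- The diagonal entry at `b' k` is `∑_n μ_n |⟨b_n, b'_k⟩|²`. All terms are nonnegative, so the
double series may be summed over `k` first, where Parseval gives `μ_n`. -/
theorem hasTrace_of_hasSum {T : H →L[ℂ] H} (b : HilbertBasis ι ℂ H) {μ : ι → ℝ} {c : ℝ}
    (hμ : ∀ n, 0 ≤ μ n) (hT : ∀ n, T (b n) = (μ n : ℂ) • b n) (hc : HasSum μ c) :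
    HasTrace T (c : ℂ) := by
  intro κ b'
  have hfib : ∀ n, HasSum (fun k => μ n * ‖inner ℂ (b n) (b' k)‖ ^ 2) (μ n) := by
    intro n
    have h := hasSum_sq_repr b' (b n)
    have hn : ‖b n‖ = 1 := b.orthonormal.1 n
    rw [hn, one_pow] at h
    have h2 := h.mul_left (μ n)
    rw [mul_one] at h2
    refine h2.congr_fun fun k => ?_
    rw [b'.repr_apply_apply, ← inner_conj_symm, RCLike.norm_conj]
  have hsum : Summable fun p : ι × κ => μ p.1 * ‖inner ℂ (b p.1) (b' p.2)‖ ^ 2 := by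
    rw [summable_prod_of_nonneg fun p => mul_nonneg (hμ _) (by positivity)]
    refine ⟨fun n => (hfib n).summable, ?_⟩
    simp only [(hfib _).tsum_eq]
    exact hc.summable
  have htot : HasSum (fun p : ι × κ => μ p.1 * ‖inner ℂ (b p.1) (b' p.2)‖ ^ 2) c := by
    have h := hsum.hasSum.prod_fiberwise hfib
    rw [hc.unique h]
    exact hsum.hasSum
  have hrow : ∀ k, HasSum (fun n => μ n * ‖inner ℂ (b n) (b' k)‖ ^ 2)
      (∑' n, μ n * ‖inner ℂ (b n) (b' k)‖ ^ 2) := fun k =>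
    (((Equiv.prodComm κ ι).summable_iff.2 hsum).prod_factor k).hasSum
  have hval : ∀ k, inner ℂ (b' k) (T (b' k)) =
      ((∑' n, μ n * ‖inner ℂ (b n) (b' k)‖ ^ 2 : ℝ) : ℂ) := by
    intro k
    have h1 := (T.hasSum (b.hasSum_repr (b' k)))
    have h2 := h1.mapL (innerSL ℂ (b' k))
    refine h2.unique ?_
    have h3 := Complex.hasSum_ofReal.2 (hrow k)
    refine h3.congr_fun fun n => ?_
    simp only [map_smul, hT, innerSL_apply_apply, b.repr_apply_apply, smul_eq_mul]
    rw [← inner_conj_symm (b' k) (b n), mul_left_comm, RCLike.mul_conj]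
    simp
  simp only [hval]
  rw [Complex.hasSum_ofReal]
  exact ((Equiv.prodComm κ ι).hasSum_iff.2 htot).prod_fiberwise hrow

end Diagonal

/-! ### The spectrum of the Laplacian on `Q_l` -/

theorem inner_incl (l : ℕ) (u v : sections l) :
    inner ℂ (incl l u) (incl l v) = inner ℂ (smoothToL2 (toSmooth l u)) (smoothToL2 (toSmooth l v)) :=
  rfl

theorem incl_injective (l : ℕ) : Function.Injective (incl l) := by
  intro u v h
  have h1 : smoothToL2 (toSmooth l u) = smoothToL2 (toSmooth l v) := congrArg Subtype.val h
  have h2 := smoothToL2_injective h1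
  exact Subtype.ext (congrArg (fun w : Smooth => w.1) h2)

theorem inner_incl_smul_left {l : ℕ} (c : ℂ) (u : sections l) (x : L2Sections l) :
    inner ℂ (incl l (c • u)) x = (starRingEnd ℂ) c * inner ℂ (incl l u) x := by
  rw [map_smul]
  exact inner_smul_left (incl l u) x c

theorem inner_incl_smul_right {l : ℕ} (c : ℂ) (u : sections l) (x : L2Sections l) :
    inner ℂ x (incl l (c • u)) = c * inner ℂ x (incl l u) := by
  rw [map_smul]
  exact inner_smul_right x (incl l u) c

theorem inner_restrictedLaplacian (l : ℕ) (u v : sections l) :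
    inner ℂ (incl l u) (incl l (restrictedLaplacian l v)) =
      inner ℂ (incl l (restrictedLaplacian l u)) (incl l v) := by
  rw [inner_incl, inner_incl, toSmooth_restrictedLaplacian, toSmooth_restrictedLaplacian]
  simp only [map_sub, map_smul, inner_sub_left, inner_sub_right, inner_smul_left, inner_smul_right]
  rw [inner_lowering_raising]
  simp only [map_neg, map_mul, map_add, map_natCast, map_one, map_ofNat]

theorem fin_mult_le {l j : ℕ} (a : Fin (mult l j)) : (a : ℕ) ≤ 2 * l + 1 + 2 * j := by
  have h := a.2
  unfold mult at h
  omega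

/-- The eigensections: ladders of holomorphic monomials of degree `2 l + 1 + 2 j`. -/
def eigensection (l : ℕ) (p : Σ j : ℕ, Fin (mult l j)) : sections l :=
  ofWeight (ladder p.1 p.2 (2 * l + 1 + 2 * p.1 - p.2)) (by
    have h := ladder_mem_weight p.1 p.2 (2 * l + 1 + 2 * p.1 - p.2)
    have h2 := fin_mult_le p.2
    convert h using 2
    push_cast [h2]
    ring)

theorem toSmooth_eigensection (l : ℕ) (p : Σ j : ℕ, Fin (mult l j)) :
    toSmooth l (eigensection l p) = ladder p.1 p.2 (2 * l + 1 + 2 * p.1 - p.2) := rfl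

theorem toSmooth_injective (l : ℕ) : Function.Injective (toSmooth l) := fun _ _ h =>
  Subtype.ext (congrArg (fun w : Smooth => w.1) h)

theorem restrictedLaplacian_eigensection (l : ℕ) (p : Σ j : ℕ, Fin (mult l j)) :
    restrictedLaplacian l (eigensection l p) = (eigval l p.1 : ℂ) • eigensection l p := by
  apply toSmooth_injective
  rw [toSmooth_restrictedLaplacian, map_smul, toSmooth_eigensection, lowering_raising_ladder,
    smul_smul, ← sub_smul]
  congr 1
  rw [Nat.cast_sub (fin_mult_le p.2), eigval]
  push_cast
  ring

theorem eigensection_ne_zero (l : ℕ) (p : Σ j : ℕ, Fin (mult l j)) : eigensection l p ≠ 0 := by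
  intro h
  have h1 := congrArg (toSmooth l) h
  rw [toSmooth_eigensection, map_zero] at h1
  have h2 := fin_mult_le p.2
  exact ladder_ne_zero (by omega) h1

theorem eigval_strictMono (l : ℕ) : StrictMono (eigval l) := by
  intro j k h
  unfold eigval
  have h1 : (j : ℝ) < k := by exact_mod_cast h
  have h2 : (0 : ℝ) ≤ j := Nat.cast_nonneg j
  have h3 : (0 : ℝ) ≤ l := Nat.cast_nonneg l
  nlinarith

theorem repr_eq_of_eigen {l : ℕ} {u v : sections l} {a : ℝ}
    (hu : restrictedLaplacian l u = (a : ℂ) • u) :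
    inner ℂ (incl l u) (incl l (restrictedLaplacian l v)) = a * inner ℂ (incl l u) (incl l v) := by
  rw [inner_restrictedLaplacian, hu, inner_incl_smul_left, Complex.conj_ofReal]

/-- For equal `j` the underlying monomials have different torus characters. For different `j` a
symmetric operator has distinct eigenvalues. -/
theorem inner_eigensection (l : ℕ) {p q : Σ j : ℕ, Fin (mult l j)} (h : p ≠ q) :
    inner ℂ (incl l (eigensection l p)) (incl l (eigensection l q)) = 0 := by
  obtain ⟨j, a⟩ := p
  obtain ⟨k, b⟩ := q
  by_cases hjk : j = k
  · subst hjk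
    have hab : (a : ℕ) ≠ b := fun hab => h (by rw [Fin.ext hab])
    rw [inner_incl]
    exact inner_ladder_eq_zero hab
  · have h1 := repr_eq_of_eigen (v := eigensection l ⟨k, b⟩)
      (restrictedLaplacian_eigensection l ⟨j, a⟩)
    rw [restrictedLaplacian_eigensection, inner_incl_smul_right] at h1
    have hne : (eigval l k : ℂ) - (eigval l j : ℂ) ≠ 0 :=
      sub_ne_zero.2 fun he => hjk ((eigval_strictMono l).injective (Complex.ofReal_injective he)).symm
    have h2 : ((eigval l k : ℂ) - (eigval l j : ℂ)) *
        inner ℂ (incl l (eigensection l ⟨j, a⟩)) (incl l (eigensection l ⟨k, b⟩)) = 0 := by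
      rw [sub_mul, h1, sub_self]
    exact (mul_eq_zero.1 h2).resolve_left hne

/-- The normalized eigensections. -/
def unitEigensection (l : ℕ) (p : Σ j : ℕ, Fin (mult l j)) : sections l :=
  ((‖incl l (eigensection l p)‖ : ℂ)⁻¹) • eigensection l p

theorem restrictedLaplacian_unitEigensection (l : ℕ) (p : Σ j : ℕ, Fin (mult l j)) :
    restrictedLaplacian l (unitEigensection l p) = (eigval l p.1 : ℂ) • unitEigensection l p := by
  rw [unitEigensection, map_smul, restrictedLaplacian_eigensection, smul_comm]

theorem orthonormal_unitEigensection (l : ℕ) :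
    Orthonormal ℂ fun p => incl l (unitEigensection l p) := by
  constructor
  · intro p
    have h : incl l (eigensection l p) ≠ 0 := fun h =>
      eigensection_ne_zero l p (incl_injective l (by rw [h, map_zero]))
    change ‖incl l (((‖incl l (eigensection l p)‖ : ℂ)⁻¹) • eigensection l p)‖ = 1
    rw [map_smul]
    exact norm_smul_inv_norm h
  · intro p q hpq
    change inner ℂ (incl l (unitEigensection l p)) (incl l (unitEigensection l q)) = 0
    rw [unitEigensection, unitEigensection, inner_incl_smul_left, inner_incl_smul_right,
      inner_eigensection l hpq, mul_zero, mul_zero]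

theorem inner_eq_zero_of_mem_L2Sections {l : ℕ} {w : ℤ} (hw : w ≠ 2 * l + 1) {u : Smooth}
    (hu : u ∈ weight w) (x : L2Sections l) :
    inner ℂ (smoothToL2 u) (x : Lp ℂ 2 hopfMeasure) = 0 := by
  have hle : L2Sections l ≤ (Submodule.span ℂ {smoothToL2 u})ᗮ := by
    refine Submodule.topologicalClosure_minimal _ ?_ (Submodule.isClosed_orthogonal _)
    rintro y ⟨v, hv⟩
    rw [← hv, Submodule.mem_orthogonal_singleton_iff_inner_right, toL2_eq]
    exact inner_eq_zero_of_weight_ne hw hu (toSmooth_mem_weight l v)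
  exact Submodule.mem_orthogonal_singleton_iff_inner_right.1 (hle x.2)

/-- A vector orthogonal to all eigensections is orthogonal to every ladder: those of weight `2l+1`
are eigensections, and all others are orthogonal to `L2Sections l` by their weight. Completeness of
the ladders in `L²(S³)` then applies. -/
theorem orthogonal_span_unitEigensection (l : ℕ) :
    (Submodule.span ℂ (Set.range fun p => incl l (unitEigensection l p)))ᗮ = ⊥ := by
  rw [Submodule.eq_bot_iff]
  intro x hx
  have h0 : ∀ p, inner ℂ (incl l (eigensection l p)) x = 0 := by
    intro p
    have h := (Submodule.mem_orthogonal _ x).1 hx _ (Submodule.subset_span ⟨p, rfl⟩)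
    simp only [unitEigensection] at h
    rw [inner_incl_smul_left] at h
    refine (mul_eq_zero.1 h).resolve_left ?_
    rw [map_inv₀, Complex.conj_ofReal]
    refine inv_ne_zero (Complex.ofReal_ne_zero.2 (norm_ne_zero_iff.2 fun h =>
      eigensection_ne_zero l p (incl_injective l (by rw [h, map_zero]))))
  apply Subtype.ext
  refine eq_zero_of_inner_ladder fun j a b => ?_
  by_cases hw : (a + b - 2 * j : ℤ) = 2 * l + 1
  · have ha : a < mult l j := by
      unfold mult
      omega
    have hb : b = 2 * l + 1 + 2 * j - a := by omega
    rw [hb]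
    exact h0 ⟨j, ⟨a, ha⟩⟩
  · exact inner_eq_zero_of_mem_L2Sections hw (ladder_mem_weight j a b) x

/-- The Hilbert basis of eigensections. -/
def eigenbasis (l : ℕ) : HilbertBasis (Σ j : ℕ, Fin (mult l j)) ℂ (L2Sections l) :=
  HilbertBasis.mkOfOrthogonalEqBot (orthonormal_unitEigensection l)
    (orthogonal_span_unitEigensection l)

theorem eigenbasis_apply (l : ℕ) (p : Σ j : ℕ, Fin (mult l j)) :
    eigenbasis l p = incl l (unitEigensection l p) := by
  rw [eigenbasis, HilbertBasis.coe_mkOfOrthogonalEqBot]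

theorem repr_restrictedLaplacian (l : ℕ) (p : Σ j : ℕ, Fin (mult l j)) (u : sections l) :
    (eigenbasis l).repr (incl l (restrictedLaplacian l u)) p =
      eigval l p.1 * (eigenbasis l).repr (incl l u) p := by
  rw [HilbertBasis.repr_apply_apply, HilbertBasis.repr_apply_apply, eigenbasis_apply]
  exact repr_eq_of_eigen (restrictedLaplacian_unitEigensection l p)

theorem repr_eq_zero_of_mem_eigenspace {l : ℕ} {μ : ℂ} {u : sections l}
    (hu : restrictedLaplacian l u = μ • u) {p : Σ j : ℕ, Fin (mult l j)}
    (hp : μ ≠ (eigval l p.1 : ℂ)) : (eigenbasis l).repr (incl l u) p = 0 := by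
  have h := repr_restrictedLaplacian l p u
  rw [hu, map_smul, map_smul, lp.coeFn_smul, Pi.smul_apply, smul_eq_mul] at h
  have h2 : (μ - eigval l p.1) * (eigenbasis l).repr (incl l u) p = 0 := by
    rw [sub_mul, h, sub_self]
  exact (mul_eq_zero.1 h2).resolve_left (sub_ne_zero.2 hp)

theorem hasEigenvalue_restrictedLaplacian_iff (l : ℕ) (μ : ℂ) :
    (restrictedLaplacian l).HasEigenvalue μ ↔ ∃ j : ℕ, μ = (eigval l j : ℂ) := by
  constructor
  · intro h
    obtain ⟨u, hu⟩ := h.exists_hasEigenvector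
    by_contra! hcon
    refine hu.2 (incl_injective l (eq_of_repr_eq (eigenbasis l) fun p => ?_))
    rw [repr_eq_zero_of_mem_eigenspace hu.apply_eq_smul (hcon p.1)]
    simp
  · rintro ⟨j, rfl⟩
    let p : Σ j : ℕ, Fin (mult l j) := ⟨j, ⟨0, by unfold mult; omega⟩⟩
    exact Module.End.hasEigenvalue_of_hasEigenvector (x := eigensection l p)
      ⟨Module.End.mem_eigenspace_iff.2 (restrictedLaplacian_eigensection l p),
        eigensection_ne_zero l p⟩

theorem eigenspace_restrictedLaplacian (l j : ℕ) :
    (restrictedLaplacian l).eigenspace (eigval l j : ℂ) =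
      Submodule.span ℂ (Set.range fun a : Fin (mult l j) => unitEigensection l ⟨j, a⟩) := by
  apply le_antisymm
  · intro u hu
    rw [Module.End.mem_eigenspace_iff] at hu
    have hsum : u = ∑ a : Fin (mult l j),
        (eigenbasis l).repr (incl l u) ⟨j, a⟩ • unitEigensection l ⟨j, a⟩ := by
      refine incl_injective l (eq_of_repr_eq (eigenbasis l) fun p => ?_)
      obtain ⟨k, b⟩ := p
      rw [(eigenbasis l).repr_apply_apply _ ⟨k, b⟩, (eigenbasis l).repr_apply_apply _ ⟨k, b⟩,
        map_sum, inner_sum]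
      simp only [inner_incl_smul_right, ← eigenbasis_apply]
      have ho := orthonormal_iff_ite.1 (eigenbasis l).orthonormal
      by_cases hk : k = j
      · subst hk
        rw [Finset.sum_eq_single b]
        · rw [ho, if_pos rfl, mul_one, ← HilbertBasis.repr_apply_apply]
        · intro a _ ha
          rw [ho, if_neg (fun h => ha (by simpa using h.symm)), mul_zero]
        · simp
      · rw [Finset.sum_eq_zero, ← HilbertBasis.repr_apply_apply]
        · exact repr_eq_zero_of_mem_eigenspace hu fun he =>
            hk ((eigval_strictMono l).injective (Complex.ofReal_injective he)).symm
        · intro a _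
          rw [ho, if_neg (fun h => hk (congrArg Sigma.fst h)), mul_zero]
    rw [hsum]
    exact Submodule.sum_mem _ fun a _ =>
      Submodule.smul_mem _ _ (Submodule.subset_span ⟨a, rfl⟩)
  · rw [Submodule.span_le]
    rintro _ ⟨a, rfl⟩
    exact Module.End.mem_eigenspace_iff.2 (restrictedLaplacian_unitEigensection l ⟨j, a⟩)

theorem finrank_eigenspace_restrictedLaplacian (l j : ℕ) :
    Module.finrank ℂ ((restrictedLaplacian l).eigenspace (eigval l j : ℂ)) = mult l j := by
  have h1 : LinearIndependent ℂ fun p => unitEigensection l p :=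
    LinearIndependent.of_comp (incl l) (orthonormal_unitEigensection l).linearIndependent
  have h2 : LinearIndependent ℂ fun a : Fin (mult l j) => unitEigensection l ⟨j, a⟩ :=
    h1.comp (Sigma.mk j) sigma_mk_injective
  rw [eigenspace_restrictedLaplacian, finrank_span_eq_card h2, Fintype.card_fin]

/-! ### The heat semigroup and its trace -/

theorem neg_le_eigval (l j : ℕ) : -(3 * (2 * (l : ℝ) + 1) ^ 2 + 1) ≤ eigval l j := by
  unfold eigval
  nlinarith [sq_nonneg ((l : ℝ) + j + 1)]

theorem exists_isHeatSemigroup_restrictedLaplacian (l : ℕ) :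
    ∃ S, IsHeatSemigroup (incl l) (restrictedLaplacian l) S :=
  exists_isHeatSemigroup (incl l) (restrictedLaplacian l) (eigenbasis l)
    (lam := fun p => eigval l p.1) (by positivity) (fun p => neg_le_eigval l p.1)
    (repr_restrictedLaplacian l)

theorem hasTrace_heatSemigroup {l : ℕ} {S : ℝ → L2Sections l →L[ℂ] L2Sections l}
    (hS : IsHeatSemigroup (incl l) (restrictedLaplacian l) S) {t : ℝ} (ht : 0 ≤ t) {K : ℝ}
    (hK : HasSum (fun j : ℕ => (mult l j : ℝ) * Real.exp (-t * eigval l j)) K) :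
    HasTrace (S t) (K : ℂ) := by
  refine hasTrace_of_hasSum (eigenbasis l) (μ := fun p => Real.exp (-t * eigval l p.1))
    (fun p => (Real.exp_pos _).le) (fun p => ?_) ?_
  · rw [eigenbasis_apply]
    exact hS.apply_eigenvector (restrictedLaplacian_unitEigensection l p) ht
  · have hfib : ∀ j, HasSum (fun _ : Fin (mult l j) => Real.exp (-t * eigval l j))
        ((mult l j : ℝ) * Real.exp (-t * eigval l j)) := fun j => by
      have h := hasSum_fintype fun _ : Fin (mult l j) => Real.exp (-t * eigval l j)
      simpa using h
    have hsum : Summable fun p : Σ j : ℕ, Fin (mult l j) => Real.exp (-t * eigval l p.1) := by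
      rw [summable_sigma_of_nonneg fun p => (Real.exp_pos _).le]
      refine ⟨fun j => (hfib j).summable, ?_⟩
      simp only [(hfib _).tsum_eq]
      exact hK.summable
    rw [hK.unique (hsum.hasSum.sigma hfib)]
    exact hsum.hasSum

/-! ### The sums `∑ n exp (-s n²)` -/

theorem abs_exp_sub_sum_le (x : ℝ) (n : ℕ) :
    |Real.exp x - ∑ i ∈ Finset.range n, x ^ i / (i.factorial : ℝ)| ≤ |x| ^ n * Real.exp |x| := by
  have h := Complex.norm_exp_sub_sum_le_norm_mul_exp (x : ℂ) n
  rw [Complex.norm_real, Real.norm_eq_abs] at h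
  have e : Complex.exp x - ∑ i ∈ Finset.range n, (x : ℂ) ^ i / (i.factorial : ℂ) =
      ((Real.exp x - ∑ i ∈ Finset.range n, x ^ i / (i.factorial : ℝ) : ℝ) : ℂ) := by
    push_cast
    rfl
  rwa [e, Complex.norm_real, Real.norm_eq_abs] at h

theorem abs_sinh_sub_le {x : ℝ} (hx : 0 ≤ x) :
    |Real.sinh x - (x + x ^ 3 / 6 + x ^ 5 / 120)| ≤ x ^ 7 * Real.exp x := by
  have h1 := abs_exp_sub_sum_le x 7
  have h2 := abs_exp_sub_sum_le (-x) 7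
  rw [abs_neg] at h2
  rw [abs_of_nonneg hx] at h1 h2
  simp only [Finset.sum_range_succ, Finset.sum_range_zero, Nat.factorial] at h1 h2
  norm_num at h1 h2
  rw [abs_le] at h1 h2 ⊢
  rw [Real.sinh_eq]
  constructor <;> nlinarith [h1.1, h1.2, h2.1, h2.2]

/-- The weights `3/2, -3/10, 1/30` solve the linear system that makes the coefficient of `y` equal
to `1` and those of `y³` and `y⁵` equal to `0`. The remainders sum to `3/2 + (3/10)·2⁷ + (1/30)·3⁷ <
200`. -/
theorem abs_sinh_combination_sub_le {y : ℝ} (hy : 0 ≤ y) :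
    |3 / 2 * Real.sinh y - 3 / 10 * Real.sinh (2 * y) + 1 / 30 * Real.sinh (3 * y) - y| ≤
      200 * (y ^ 7 * Real.exp (3 * y)) := by
  have h1 := abs_sinh_sub_le hy
  have h2 := abs_sinh_sub_le (x := 2 * y) (by linarith)
  have h3 := abs_sinh_sub_le (x := 3 * y) (by linarith)
  have hp : 0 ≤ y ^ 7 := by positivity
  have e1 : y ^ 7 * Real.exp y ≤ y ^ 7 * Real.exp (3 * y) :=
    mul_le_mul_of_nonneg_left (Real.exp_le_exp.2 (by linarith)) hp
  have e2 : y ^ 7 * Real.exp (2 * y) ≤ y ^ 7 * Real.exp (3 * y) :=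
    mul_le_mul_of_nonneg_left (Real.exp_le_exp.2 (by linarith)) hp
  have e0 : 0 ≤ y ^ 7 * Real.exp (3 * y) := by positivity
  simp only [mul_pow] at h2 h3
  rw [abs_le] at h1 h2 h3 ⊢
  constructor <;> nlinarith [h1.1, h1.2, h2.1, h2.2, h3.1, h3.2]

/-- Sums over windows of length `N` turn the step-`N` differences into step-one differences, which
telescope. -/
theorem hasSum_sub_shift {f : ℕ → ℝ} (N : ℕ) (hf : Tendsto f atTop (𝓝 0))
    (h : ∀ n, 0 ≤ f n - f (n + N)) :
    HasSum (fun n => f n - f (n + N)) (∑ i ∈ Finset.range N, f i) := by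
  rw [hasSum_iff_tendsto_nat_of_nonneg h]
  let g : ℕ → ℝ := fun n => ∑ i ∈ Finset.range N, f (n + i)
  have hg : ∀ n, f n - f (n + N) = g n - g (n + 1) := by
    intro n
    have h1 := Finset.sum_range_succ (fun i => f (n + i)) N
    have h2 := Finset.sum_range_succ' (fun i => f (n + i)) N
    have h3 : g (n + 1) = ∑ i ∈ Finset.range N, f (n + (i + 1)) :=
      Finset.sum_congr rfl fun i _ => by rw [add_assoc, add_comm 1 i]
    rw [h3]
    simp only [add_zero] at h2
    change _ = (∑ i ∈ Finset.range N, f (n + i)) - _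
    linarith
  have hlim : Tendsto g atTop (𝓝 0) := by
    have : Tendsto g atTop (𝓝 (∑ _i ∈ Finset.range N, (0 : ℝ))) :=
      tendsto_finsetSum _ fun i _ => hf.comp (tendsto_add_atTop_nat i)
    simpa using this
  simp only [hg, Finset.sum_range_sub']
  have h0 : g 0 = ∑ i ∈ Finset.range N, f i := by simp [g]
  rw [← h0]
  simpa using (tendsto_const_nhds (x := g 0)).sub hlim

/-- Completing the square, `e^{-sn² ± Nsn}` equals `e^{sN²/4}` times a Gaussian centred at `±N/2`.
The two Gaussians differ by a shift of `N`, so the series telescopes. -/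
theorem hasSum_exp_mul_sinh {s : ℝ} (hs : 0 < s) (N : ℕ) :
    HasSum (fun n : ℕ => Real.exp (-s * n ^ 2) * Real.sinh (N * (s * n)))
      (Real.exp (s * N ^ 2 / 4) / 2 * ∑ i ∈ Finset.range N, Real.exp (-s * (i - N / 2) ^ 2)) := by
  let f : ℕ → ℝ := fun n => Real.exp (-s * (n - N / 2) ^ 2)
  have hterm : ∀ n : ℕ, Real.exp (-s * n ^ 2) * Real.sinh (N * (s * n)) =
      Real.exp (s * N ^ 2 / 4) / 2 * (f n - f (n + N)) := by
    intro n
    simp only [f]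
    rw [Real.sinh_eq, mul_div_assoc', div_mul_eq_mul_div, mul_sub, mul_sub, ← Real.exp_add,
      ← Real.exp_add, ← Real.exp_add, ← Real.exp_add]
    congr 3
    · ring
    · push_cast
      ring
  have hf : Tendsto f atTop (𝓝 0) := by
    refine Real.tendsto_exp_atBot.comp ?_
    have h1 : Tendsto (fun n : ℕ => (n : ℝ) - N / 2) atTop atTop :=
      tendsto_atTop_add_const_right _ _ tendsto_natCast_atTop_atTop
    have h2 := (tendsto_pow_atTop (two_ne_zero)).comp h1
    exact h2.const_mul_atTop_of_neg (neg_lt_zero.2 hs)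
  have hnn : ∀ n, 0 ≤ f n - f (n + N) := by
    intro n
    have h1 : 0 ≤ Real.exp (-s * n ^ 2) * Real.sinh (N * (s * n)) :=
      mul_nonneg (Real.exp_pos _).le (Real.sinh_nonneg_iff.2 (by positivity))
    rw [hterm] at h1
    exact nonneg_of_mul_nonneg_right h1 (by positivity)
  simp only [hterm]
  exact (hasSum_sub_shift N hf hnn).mul_left _

theorem hasSum_exp_mul_sinh_one {s : ℝ} (hs : 0 < s) :
    HasSum (fun n : ℕ => Real.exp (-s * n ^ 2) * Real.sinh (s * n)) (1 / 2) := by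
  have h := hasSum_exp_mul_sinh hs 1
  convert h using 1
  · simp
  · rw [Finset.sum_range_one, div_mul_eq_mul_div, ← Real.exp_add]
    congr 1
    rw [eq_comm, Real.exp_eq_one_iff]
    push_cast
    ring

theorem hasSum_exp_mul_sinh_two {s : ℝ} (hs : 0 < s) :
    HasSum (fun n : ℕ => Real.exp (-s * n ^ 2) * Real.sinh (2 * (s * n)))
      ((1 + Real.exp s) / 2) := by
  have h := hasSum_exp_mul_sinh hs 2
  convert h using 1
  · simp
  · rw [Finset.sum_range_succ, Finset.sum_range_one, div_mul_eq_mul_div, mul_add, ← Real.exp_add,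
      ← Real.exp_add]
    have e1 : s * ((2 : ℕ) : ℝ) ^ 2 / 4 + -s * (((0 : ℕ) : ℝ) - ((2 : ℕ) : ℝ) / 2) ^ 2 = 0 := by
      push_cast
      ring
    have e2 : s * ((2 : ℕ) : ℝ) ^ 2 / 4 + -s * (((1 : ℕ) : ℝ) - ((2 : ℕ) : ℝ) / 2) ^ 2 = s := by
      push_cast
      ring
    rw [e1, e2, Real.exp_zero]

theorem hasSum_exp_mul_sinh_three {s : ℝ} (hs : 0 < s) :
    HasSum (fun n : ℕ => Real.exp (-s * n ^ 2) * Real.sinh (3 * (s * n)))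
      ((1 + 2 * Real.exp (2 * s)) / 2) := by
  have h := hasSum_exp_mul_sinh hs 3
  convert h using 1
  · simp
  · rw [Finset.sum_range_succ, Finset.sum_range_succ, Finset.sum_range_one, div_mul_eq_mul_div,
      mul_add, mul_add, ← Real.exp_add, ← Real.exp_add, ← Real.exp_add]
    have e1 : s * ((3 : ℕ) : ℝ) ^ 2 / 4 + -s * (((0 : ℕ) : ℝ) - ((3 : ℕ) : ℝ) / 2) ^ 2 = 0 := by
      push_cast
      ring
    have e2 : s * ((3 : ℕ) : ℝ) ^ 2 / 4 + -s * (((1 : ℕ) : ℝ) - ((3 : ℕ) : ℝ) / 2) ^ 2 = 2 * s := by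
      push_cast
      ring
    have e3 : s * ((3 : ℕ) : ℝ) ^ 2 / 4 + -s * (((2 : ℕ) : ℝ) - ((3 : ℕ) : ℝ) / 2) ^ 2 = 2 * s := by
      push_cast
      ring
    rw [e1, e2, e3, Real.exp_zero]
    ring

/-- From `y ≤ sinh y`. Comparison with the exact sum for `N = 1` gives summability and the bound `s
∑ n e^{-sn²} ≤ 1/2`. -/
theorem mul_exp_le {s : ℝ} (hs : 0 < s) (n : ℕ) :
    s * (n * Real.exp (-s * n ^ 2)) ≤ Real.exp (-s * n ^ 2) * Real.sinh (s * n) := by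
  have h : s * n ≤ Real.sinh (s * n) := Real.self_le_sinh_iff.2 (by positivity)
  nlinarith [Real.exp_pos (-s * (n : ℝ) ^ 2)]

theorem summable_mul_exp {s : ℝ} (hs : 0 < s) :
    Summable fun n : ℕ => (n : ℝ) * Real.exp (-s * n ^ 2) := by
  have h : Summable fun n : ℕ => s * ((n : ℝ) * Real.exp (-s * n ^ 2)) :=
    Summable.of_nonneg_of_le (fun n => by positivity) (mul_exp_le hs)
      (hasSum_exp_mul_sinh_one hs).summable
  exact (summable_mul_left_iff hs.ne').1 h

theorem mul_tsum_mul_exp_le {s : ℝ} (hs : 0 < s) :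
    s * ∑' n : ℕ, (n : ℝ) * Real.exp (-s * n ^ 2) ≤ 1 / 2 := by
  rw [← tsum_mul_left]
  exact hasSum_le (mul_exp_le hs) ((summable_mul_exp hs).mul_left s).hasSum
    (hasSum_exp_mul_sinh_one hs)

/-- Write `(sn)⁷ = s⁴ n x³` with `x = sn²`. Half of the Gaussian exponent pays for the other
factors: `3sn ≤ 9/2 + x/4 + x/4`, where one `x/4` also absorbs `x³ ≤ 4³·3!·e^{x/4}`, and `e^{-x/2}`
becomes the product of the two remaining decays. -/
theorem pow_seven_mul_exp_le {s : ℝ} (hs : 0 < s) (hs1 : s ≤ 1) (n : ℕ) :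
    Real.exp (-s * n ^ 2) * ((s * n) ^ 7 * Real.exp (3 * (s * n))) ≤
      384 * Real.exp (9 / 2) * s ^ 4 * (n * Real.exp (-(s / 4) * n ^ 2)) := by
  set x : ℝ := s * n ^ 2 with hx
  have hx0 : 0 ≤ x := by positivity
  have h1 : Real.exp (-s * n ^ 2) * Real.exp (3 * (s * n)) ≤
      Real.exp (9 / 2) * (Real.exp (-(s / 4) * n ^ 2) * Real.exp (-(x / 4))) := by
    rw [← Real.exp_add, ← Real.exp_add, ← Real.exp_add]
    refine Real.exp_le_exp.2 ?_
    rw [hx]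
    nlinarith [mul_nonneg hs.le (sq_nonneg ((n : ℝ) - 3))]
  have h2 : x ^ 3 ≤ 384 * Real.exp (x / 4) := by
    have := Real.pow_div_factorial_le_exp (x / 4) (by positivity) 3
    simp only [Nat.factorial] at this
    norm_num at this
    nlinarith
  have h3 : x ^ 3 * Real.exp (-(x / 4)) ≤ 384 := by
    have e : Real.exp (x / 4) * Real.exp (-(x / 4)) = 1 := by rw [← Real.exp_add]; simp
    nlinarith [Real.exp_pos (-(x / 4))]
  calc Real.exp (-s * n ^ 2) * ((s * n) ^ 7 * Real.exp (3 * (s * n)))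
      = s ^ 4 * n * x ^ 3 * (Real.exp (-s * n ^ 2) * Real.exp (3 * (s * n))) := by
        rw [hx]; ring
    _ ≤ s ^ 4 * n * x ^ 3 *
        (Real.exp (9 / 2) * (Real.exp (-(s / 4) * n ^ 2) * Real.exp (-(x / 4)))) :=
        mul_le_mul_of_nonneg_left h1 (by positivity)
    _ = s ^ 4 * n * Real.exp (9 / 2) * Real.exp (-(s / 4) * n ^ 2) *
        (x ^ 3 * Real.exp (-(x / 4))) := by ring
    _ ≤ s ^ 4 * n * Real.exp (9 / 2) * Real.exp (-(s / 4) * n ^ 2) * 384 :=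
        mul_le_mul_of_nonneg_left h3 (by positivity)
    _ = _ := by ring

theorem exists_abs_tsum_mul_exp_sub_le : ∃ C : ℝ, ∀ s : ℝ, 0 < s → s ≤ 1 →
    |s * ∑' n : ℕ, (n : ℝ) * Real.exp (-s * n ^ 2)
      - (3 / 4 - 3 / 20 * (1 + Real.exp s) + 1 / 60 * (1 + 2 * Real.exp (2 * s)))| ≤ C * s ^ 3 := by
  refine ⟨200 * (384 * Real.exp (9 / 2)) * 2, fun s hs hs1 => ?_⟩
  have hA := (((hasSum_exp_mul_sinh_one hs).mul_left (3 / 2)).sub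
    ((hasSum_exp_mul_sinh_two hs).mul_left (3 / 10))).add
    ((hasSum_exp_mul_sinh_three hs).mul_left (1 / 30))
  have hM := (summable_mul_exp hs).hasSum.mul_left s
  have hd := hA.sub hM
  have hs4 : 0 < s / 4 := by positivity
  -- The majorant carries `s⁴` times the same kind of series at `s/4`, which is at most `2/s`; this
  -- leaves `s³`.
  have hbs := ((summable_mul_exp hs4).hasSum.mul_left (384 * Real.exp (9 / 2) * s ^ 4)).mul_left 200
  have hle := hd.norm_le_of_bounded hbs fun n => by
    have h1 := abs_sinh_combination_sub_le (y := s * n) (by positivity)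
    have h2 := pow_seven_mul_exp_le hs hs1 n
    have e : 3 / 2 * (Real.exp (-s * n ^ 2) * Real.sinh (s * n))
        - 3 / 10 * (Real.exp (-s * n ^ 2) * Real.sinh (2 * (s * n)))
        + 1 / 30 * (Real.exp (-s * n ^ 2) * Real.sinh (3 * (s * n)))
        - s * (n * Real.exp (-s * n ^ 2)) = Real.exp (-s * n ^ 2) *
        (3 / 2 * Real.sinh (s * n) - 3 / 10 * Real.sinh (2 * (s * n))
          + 1 / 30 * Real.sinh (3 * (s * n)) - s * n) := by ring
    rw [e, norm_mul, Real.norm_eq_abs, Real.norm_eq_abs, abs_of_pos (Real.exp_pos _)]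
    have h3 := mul_le_mul_of_nonneg_left h1 (Real.exp_pos (-s * (n : ℝ) ^ 2)).le
    linarith
  rw [Real.norm_eq_abs, abs_sub_comm] at hle
  have hb := mul_tsum_mul_exp_le hs4
  have hE := Real.exp_pos (9 / 2)
  have hs3 : 0 < s ^ 3 := by positivity
  have e2 : s * ∑' n : ℕ, (n : ℝ) * Real.exp (-s * n ^ 2)
      - (3 / 4 - 3 / 20 * (1 + Real.exp s) + 1 / 60 * (1 + 2 * Real.exp (2 * s))) =
      s * ∑' n : ℕ, (n : ℝ) * Real.exp (-s * n ^ 2)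
      - (3 / 2 * (1 / 2) - 3 / 10 * ((1 + Real.exp s) / 2)
        + 1 / 30 * ((1 + 2 * Real.exp (2 * s)) / 2)) := by ring
  rw [e2]
  refine hle.trans ?_
  have h5 : 200 * (384 * Real.exp (9 / 2) * s ^ 4 * ∑' n : ℕ, (n : ℝ) * Real.exp (-(s / 4) * n ^ 2))
      = 200 * (384 * Real.exp (9 / 2)) * 4 * s ^ 3 *
        (s / 4 * ∑' n : ℕ, (n : ℝ) * Real.exp (-(s / 4) * n ^ 2)) := by ring
  rw [h5]
  calc _ ≤ 200 * (384 * Real.exp (9 / 2)) * 4 * s ^ 3 * (1 / 2) :=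
        mul_le_mul_of_nonneg_left hb (by positivity)
    _ = _ := by ring

/-! ### The expansion of the heat trace -/

theorem isBigO_exp_sub_sum (c : ℝ) (n : ℕ) :
    (fun t : ℝ => Real.exp (c * t) - ∑ i ∈ Finset.range n, (c * t) ^ i / (i.factorial : ℝ))
      =O[𝓝[>] 0] fun t => t ^ n := by
  refine IsBigO.of_bound (|c| ^ n * Real.exp |c|) ?_
  filter_upwards [Ioo_mem_nhdsGT (show (0 : ℝ) < 1 by norm_num)] with t ht
  have h := abs_exp_sub_sum_le (c * t) n
  rw [Real.norm_eq_abs, Real.norm_eq_abs, abs_pow]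
  refine h.trans ?_
  rw [abs_mul, mul_pow, mul_right_comm]
  refine mul_le_mul_of_nonneg_right ?_ (by positivity)
  refine mul_le_mul_of_nonneg_left (Real.exp_le_exp.2 ?_) (by positivity)
  rw [abs_of_pos ht.1]
  nlinarith [abs_nonneg c, ht.1, ht.2]

theorem isBigO_exp_quadratic (c : ℝ) :
    (fun t : ℝ => Real.exp (c * t) - (1 + c * t + c ^ 2 / 2 * t ^ 2)) =O[𝓝[>] 0] fun t => t ^ 3 := by
  refine (isBigO_exp_sub_sum c 3).congr_left fun t => ?_
  simp only [Finset.sum_range_succ, Finset.sum_range_zero, Nat.factorial]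
  push_cast
  ring

theorem isBigO_mul_exp_linear (c : ℝ) :
    (fun t : ℝ => t * Real.exp (c * t) - (t + c * t ^ 2)) =O[𝓝[>] 0] fun t => t ^ 3 := by
  have h := (isBigO_refl (fun t : ℝ => t) (𝓝[>] 0)).mul (isBigO_exp_sub_sum c 2)
  refine (h.congr_left fun t => ?_).congr_right fun t => ?_
  · simp only [Finset.sum_range_succ, Finset.sum_range_zero, Nat.factorial]
    push_cast
    ring
  · ring

theorem isBigO_tsum_mul_exp :
    (fun t : ℝ => t * (2 * ∑' n : ℕ, (n : ℝ) * Real.exp (-(4 * t) * n ^ 2))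
      - (1 / 4 - t / 6 - t ^ 2 / 15)) =O[𝓝[>] 0] fun t => t ^ 3 := by
  obtain ⟨C, hC⟩ := exists_abs_tsum_mul_exp_sub_le
  have h1 : (fun t : ℝ => 4 * t * ∑' n : ℕ, (n : ℝ) * Real.exp (-(4 * t) * n ^ 2)
      - (3 / 4 - 3 / 20 * (1 + Real.exp (4 * t)) + 1 / 60 * (1 + 2 * Real.exp (8 * t))))
      =O[𝓝[>] 0] fun t => t ^ 3 := by
    refine IsBigO.of_bound (C * 64) ?_
    filter_upwards [Ioo_mem_nhdsGT (show (0 : ℝ) < 1 / 4 by norm_num)] with t ht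
    have h := hC (4 * t) (by linarith [ht.1]) (by linarith [ht.2])
    have ht0 := ht.1
    rw [Real.norm_eq_abs, Real.norm_eq_abs, abs_of_pos (pow_pos ht0 3)]
    rw [show 2 * (4 * t) = 8 * t by ring] at h
    refine h.trans (le_of_eq (by ring))
  have h2 := (isBigO_exp_quadratic 4).const_mul_left (-(3 / 40))
  have h3 := (isBigO_exp_quadratic 8).const_mul_left (1 / 60)
  refine (((h1.const_mul_left (1 / 2)).add h2).add h3).congr_left fun t => ?_
  ring

theorem sum_range_two_mul (l : ℕ) :
    ∑ n ∈ Finset.range (l + 1), 2 * (n : ℝ) = l * (l + 1) := by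
  induction l with
  | zero => simp
  | succ l ih =>
    rw [Finset.sum_range_succ, ih]
    push_cast
    ring

theorem sum_range_eight_mul_cube (l : ℕ) :
    ∑ n ∈ Finset.range (l + 1), 8 * (n : ℝ) ^ 3 = 2 * ((l : ℝ) * (l + 1)) ^ 2 := by
  induction l with
  | zero => simp
  | succ l ih =>
    rw [Finset.sum_range_succ, ih]
    push_cast
    ring

theorem isBigO_sum_range_mul_exp (l : ℕ) :
    (fun t : ℝ => t * ∑ n ∈ Finset.range (l + 1), 2 * (n : ℝ) * Real.exp (-(4 * t) * n ^ 2)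
      - ((l : ℝ) * (l + 1) * t - 2 * ((l : ℝ) * (l + 1)) ^ 2 * t ^ 2)) =O[𝓝[>] 0] fun t => t ^ 3 := by
  have h : (fun t : ℝ => ∑ n ∈ Finset.range (l + 1), 2 * (n : ℝ) *
      (t * Real.exp (-(4 * (n : ℝ) ^ 2) * t) - (t + -(4 * (n : ℝ) ^ 2) * t ^ 2)))
      =O[𝓝[>] 0] fun t => t ^ 3 :=
    IsBigO.fun_sum fun n _ => (isBigO_mul_exp_linear _).const_mul_left _
  refine h.congr_left fun t => ?_
  rw [← sum_range_eight_mul_cube, ← sum_range_two_mul, Finset.mul_sum, Finset.sum_mul,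
    Finset.sum_mul, ← Finset.sum_sub_distrib,
    ← Finset.sum_sub_distrib]
  refine Finset.sum_congr rfl fun n _ => ?_
  rw [show -(4 * t) * (n : ℝ) ^ 2 = -(4 * (n : ℝ) ^ 2) * t by ring]
  ring

/-- The heat trace of the Laplacian on `Q_l`. -/
def heatTrace (l : ℕ) (t : ℝ) : ℝ :=
  Real.exp ((3 * (2 * (l : ℝ) + 1) ^ 2 + 1) * t) *
    (2 * ∑' n : ℕ, (n : ℝ) * Real.exp (-(4 * t) * n ^ 2)
      - ∑ n ∈ Finset.range (l + 1), 2 * (n : ℝ) * Real.exp (-(4 * t) * n ^ 2))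

/-- Put `n = j+l+1`: the exponent separates into a constant and `-4t n²`, and the multiplicity is
`2n`. The sum is thus the tail of the full series from `n = l+1`. -/
theorem hasSum_heatTrace (l : ℕ) {t : ℝ} (ht : 0 < t) :
    HasSum (fun j : ℕ => (mult l j : ℝ) * Real.exp (-t * eigval l j)) (heatTrace l t) := by
  have h1 := (summable_mul_exp (s := 4 * t) (by positivity)).hasSum.mul_left 2
  have h2 := (hasSum_nat_add_iff' (l + 1)).2 h1
  have h3 := h2.mul_left (Real.exp ((3 * (2 * (l : ℝ) + 1) ^ 2 + 1) * t))
  have e : heatTrace l t = Real.exp ((3 * (2 * (l : ℝ) + 1) ^ 2 + 1) * t) *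
      (2 * ∑' n : ℕ, (n : ℝ) * Real.exp (-(4 * t) * n ^ 2)
        - ∑ n ∈ Finset.range (l + 1), 2 * ((n : ℝ) * Real.exp (-(4 * t) * n ^ 2))) := by
    simp only [heatTrace, mul_assoc]
  rw [e]
  refine h3.congr_fun fun j => ?_
  have e2 : -t * eigval l j = (3 * (2 * (l : ℝ) + 1) ^ 2 + 1) * t
      + -(4 * t) * ((j + (l + 1) : ℕ) : ℝ) ^ 2 := by
    rw [eigval]
    push_cast
    ring
  rw [e2, Real.exp_add, mult]
  push_cast
  ring

theorem heatTrace_expansion (l : ℕ) (m : ℝ) (hm : m = (l : ℝ) + 1) :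
    (fun t : ℝ => heatTrace l t - (1 / (4 * t) + (5 / 6 - 2 * m + 2 * m ^ 2)
      + t * (19 / 15 - 6 * m + 14 * m ^ 2 - 16 * m ^ 3 + 8 * m ^ 4)))
      =O[𝓝[>] 0] fun t : ℝ => t ^ 2 := by
  set c : ℝ := 3 * (2 * (l : ℝ) + 1) ^ 2 + 1 with hc
  set Y : ℝ → ℝ := fun t => t * (2 * ∑' n : ℕ, (n : ℝ) * Real.exp (-(4 * t) * n ^ 2))
    - t * ∑ n ∈ Finset.range (l + 1), 2 * (n : ℝ) * Real.exp (-(4 * t) * n ^ 2) with hY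
  set y : ℝ → ℝ := fun t => 1 / 4 - (1 / 6 + (l : ℝ) * (l + 1)) * t
    + (2 * ((l : ℝ) * (l + 1)) ^ 2 - 1 / 15) * t ^ 2 with hy
  have hYy : (fun t => Y t - y t) =O[𝓝[>] 0] fun t => t ^ 3 :=
    (isBigO_tsum_mul_exp.sub (isBigO_sum_range_mul_exp l)).congr_left fun t => by
      simp only [hY, hy]
      ring
  have hE := isBigO_exp_quadratic c
  have hone : ∀ f : ℝ → ℝ, Continuous f → f =O[𝓝[>] 0] fun _ => (1 : ℝ) := fun f hf =>
    (hf.tendsto 0).mono_left nhdsWithin_le_nhds |>.isBigO_one ℝ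
  have hprod : (fun t => t * (heatTrace l t - (1 / (4 * t) + (5 / 6 - 2 * m + 2 * m ^ 2)
      + t * (19 / 15 - 6 * m + 14 * m ^ 2 - 16 * m ^ 3 + 8 * m ^ 4)))) =O[𝓝[>] 0]
      fun t => t ^ 3 := by
    have h1 := (hone (fun t => Real.exp (c * t)) (by fun_prop)).mul hYy
    have h2 := hE.mul (hone y (by fun_prop))
    -- These are the terms of degree three and four in the product of `1 + ct + c²t²/2` with `y`.
    -- Those of lower degree are exactly `t` times the claimed expansion.
    have h3 := (isBigO_refl (fun t : ℝ => t ^ 3) (𝓝[>] 0)).mul (hone (fun t : ℝ =>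
      c * (2 * ((l : ℝ) * (l + 1)) ^ 2 - 1 / 15) - c ^ 2 / 2 * (1 / 6 + (l : ℝ) * (l + 1))
        + c ^ 2 / 2 * (2 * ((l : ℝ) * (l + 1)) ^ 2 - 1 / 15) * t) (by fun_prop))
    simp only [one_mul, mul_one] at h1 h2 h3
    refine ((h1.add h2).add h3).congr' ?_ EventuallyEq.rfl
    filter_upwards [self_mem_nhdsWithin] with t ht
    have ht0 : t ≠ 0 := (Set.mem_Ioi.1 ht).ne'
    have e1 : t * heatTrace l t = Real.exp (c * t) * Y t := by
      simp only [heatTrace, hY]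
      ring
    have e2 : t * (1 / (4 * t)) = 1 / 4 := by field_simp
    have e3 : ∀ a b h : ℝ, t * (h - (1 / (4 * t) + a + t * b)) =
        t * h - t * (1 / (4 * t)) - t * a - t ^ 2 * b := fun a b h => by ring
    rw [e3, e1, e2, hm]
    simp only [hy]
    rw [hc]
    ring
  have hinv := (isBigO_refl (fun t : ℝ => t⁻¹) (𝓝[>] 0)).mul hprod
  refine hinv.congr' ?_ ?_
  · filter_upwards [self_mem_nhdsWithin] with t ht
    exact inv_mul_cancel_left₀ (Set.mem_Ioi.1 ht).ne' _
  · filter_upwards [self_mem_nhdsWithin] with t ht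
    have ht0 : t ≠ 0 := (Set.mem_Ioi.1 ht).ne'
    field_simp

/-! ### Area and curvature of the Fubini-Study metric -/

theorem one_add_norm_sq_pos (ζ : ℂ) : 0 < 1 + ‖ζ‖ ^ 2 := by positivity

theorem hasFDerivAt_one_add_norm_sq (ζ : ℂ) :
    HasFDerivAt (fun z : ℂ => 1 + ‖z‖ ^ 2) ((2 : ℝ) • innerSL ℝ ζ) ζ := by
  have h := (hasStrictFDerivAt_norm_sq ζ).hasFDerivAt.const_add (1 : ℝ)
  simpa [two_smul] using h

theorem fderiv_fsPotential (ζ : ℂ) :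
    fderiv ℝ fsPotential ζ = -((1 + ‖ζ‖ ^ 2)⁻¹ • ((2 : ℝ) • innerSL ℝ ζ)) :=
  ((hasFDerivAt_one_add_norm_sq ζ).log (one_add_norm_sq_pos ζ).ne').neg.fderiv

theorem fderiv_fderiv_fsPotential (ζ v : ℂ) :
    fderiv ℝ (fderiv ℝ fsPotential) ζ v v =
      -(2 * inner ℝ v v) / (1 + ‖ζ‖ ^ 2) + 4 * inner ℝ ζ v ^ 2 / (1 + ‖ζ‖ ^ 2) ^ 2 := by
  have h0 := (one_add_norm_sq_pos ζ).ne'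
  have h1 : HasFDerivAt (fun z : ℂ => (1 + ‖z‖ ^ 2)⁻¹)
      (-((1 + ‖ζ‖ ^ 2) ^ 2)⁻¹ • ((2 : ℝ) • innerSL ℝ ζ)) ζ :=
    (hasDerivAt_inv h0).comp_hasFDerivAt ζ (hasFDerivAt_one_add_norm_sq ζ)
  have h2 : HasFDerivAt (fun z : ℂ => (2 : ℝ) • innerSL ℝ z) ((2 : ℝ) • innerSL ℝ) ζ :=
    ((2 : ℝ) • innerSL ℝ : ℂ →L[ℝ] ℂ →L[ℝ] ℝ).hasFDerivAt
  have h3 := (h1.smul h2).neg.fderiv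
  rw [show fderiv ℝ fsPotential = fun z : ℂ => -((1 + ‖z‖ ^ 2)⁻¹ • ((2 : ℝ) • innerSL ℝ z)) from
    funext fderiv_fsPotential]
  refine (congrArg (fun T : ℂ →L[ℝ] ℂ →L[ℝ] ℝ => T v v) h3).trans ?_
  simp only [neg_apply, add_apply,
    smul_apply, ContinuousLinearMap.smulRight_apply, innerSL_apply_apply,
    smul_eq_mul]
  rw [show innerSL ℝ v v = inner ℝ v v from rfl]
  field_simp
  ring

theorem laplacian_fsPotential (ζ : ℂ) :
    Laplacian.laplacian fsPotential ζ = -4 / (1 + ‖ζ‖ ^ 2) ^ 2 := by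
  have h0 := (one_add_norm_sq_pos ζ).ne'
  rw [InnerProductSpace.laplacian_eq_iteratedFDeriv_complexPlane]
  simp only [iteratedFDeriv_two_apply, Matrix.cons_val_zero, Matrix.cons_val_one]
  rw [fderiv_fderiv_fsPotential, fderiv_fderiv_fsPotential]
  have hn : ‖ζ‖ ^ 2 = ζ.re ^ 2 + ζ.im ^ 2 := by
    rw [← Complex.normSq_eq_norm_sq, Complex.normSq_apply]
    ring
  rw [hn] at h0 ⊢
  simp only [Complex.inner, map_one, Complex.conj_I]
  simp
  field_simp
  ring

theorem exp_two_mul_fsPotential (ζ : ℂ) :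
    Real.exp (2 * fsPotential ζ) = ((1 + ‖ζ‖ ^ 2) ^ 2)⁻¹ := by
  have h0 := one_add_norm_sq_pos ζ
  rw [fsPotential, mul_neg, Real.exp_neg, two_mul, Real.exp_add, Real.exp_log h0, sq (1 + ‖ζ‖ ^ 2)]

theorem fsScalarCurvature_eq (ζ : ℂ) : fsScalarCurvature ζ = 8 := by
  have h0 := (one_add_norm_sq_pos ζ).ne'
  rw [fsScalarCurvature, laplacian_fsPotential, neg_mul 2 (fsPotential ζ), Real.exp_neg,
    exp_two_mul_fsPotential]
  field_simp
  norm_num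

theorem integral_Ioi_mul_inv_sq :
    ∫ y in Set.Ioi (0 : ℝ), y * ((1 + y ^ 2) ^ 2)⁻¹ = 1 / 2 := by
  have hd : ∀ y ∈ Set.Ici (0 : ℝ), HasDerivAt (fun y : ℝ => -(1 / 2) * (1 + y ^ 2)⁻¹)
      (y * ((1 + y ^ 2) ^ 2)⁻¹) y := by
    intro y _
    have h0 : 1 + y ^ 2 ≠ 0 := by positivity
    have h := ((((hasDerivAt_pow 2 y).const_add 1).inv h0)).const_mul (-(1 / 2) : ℝ)
    refine h.congr_deriv ?_
    field_simp
    norm_num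
  have ht : Tendsto (fun y : ℝ => -(1 / 2) * (1 + y ^ 2)⁻¹) atTop (𝓝 0) := by
    have h1 : Tendsto (fun y : ℝ => 1 + y ^ 2) atTop atTop :=
      tendsto_atTop_add_const_left _ _ (tendsto_pow_atTop two_ne_zero)
    simpa using (tendsto_inv_atTop_zero.comp h1).const_mul (-(1 / 2) : ℝ)
  rw [integral_Ioi_of_hasDerivAt_of_nonneg' hd
    (fun y (hy : 0 < y) => by positivity) ht]
  norm_num

theorem fsArea_real_univ : fsArea.real Set.univ = Real.pi := by
  have h1 : fsArea.real Set.univ = ∫ ζ : ℂ, ((1 + ‖ζ‖ ^ 2) ^ 2)⁻¹ := by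
    rw [integral_eq_lintegral_of_nonneg_ae (Eventually.of_forall fun ζ => by positivity)
      (by fun_prop : Measurable fun ζ : ℂ => ((1 + ‖ζ‖ ^ 2) ^ 2)⁻¹).aestronglyMeasurable,
      measureReal_def, fsArea, withDensity_apply _ MeasurableSet.univ, Measure.restrict_univ]
    simp only [exp_two_mul_fsPotential]
  rw [h1, integral_fun_norm_addHaar volume (fun y : ℝ => ((1 + y ^ 2) ^ 2)⁻¹),
    Complex.finrank_real_complex]
  simp only [Nat.add_one_sub_one, pow_one, smul_eq_mul]
  rw [integral_Ioi_mul_inv_sq, measureReal_def, Complex.volume_ball]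
  simp
  ring

theorem integral_fsScalarCurvature : ∫ ζ, fsScalarCurvature ζ ∂fsArea = 8 * Real.pi := by
  simp only [fsScalarCurvature_eq, integral_const, fsArea_real_univ, smul_eq_mul]
  ring

theorem integral_fsScalarCurvature_sq :
    ∫ ζ, fsScalarCurvature ζ ^ 2 ∂fsArea = 64 * Real.pi := by
  simp only [fsScalarCurvature_eq, integral_const, fsArea_real_univ, smul_eq_mul]
  ring

end SymplecticSpinor

end

theorem mainTheorem6 (l : ℕ) (m : ℝ) (hm : m = (l : ℝ) + 1) :
    -- the Laplacian restricts to an operator on the smooth sections of `Q_l`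
    ∃ P : Module.End ℂ (SymplecticSpinor.sections l), SymplecticSpinor.IsRestriction l P ∧
    -- its eigenvalues and their multiplicities
    (∀ μ : ℂ, P.HasEigenvalue μ ↔ ∃ j : ℕ, μ = (SymplecticSpinor.eigval l j : ℂ)) ∧
    (∀ j : ℕ, Module.finrank ℂ (P.eigenspace (SymplecticSpinor.eigval l j : ℂ)) =
      SymplecticSpinor.mult l j) ∧
    -- the heat semigroup exists, and its trace is `K`
    (∃ S, SymplecticSpinor.IsHeatSemigroup (SymplecticSpinor.incl l) P S) ∧
    ∃ K : ℝ → ℝ,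
      (∀ S, SymplecticSpinor.IsHeatSemigroup (SymplecticSpinor.incl l) P S →
        ∀ t : ℝ, 0 < t → SymplecticSpinor.HasTrace (S t) (K t : ℂ)) ∧
      (∀ t : ℝ, 0 < t → HasSum (fun j : ℕ => (SymplecticSpinor.mult l j : ℝ) *
        Real.exp (-t * SymplecticSpinor.eigval l j)) (K t)) ∧
      -- the expansion as `t → +0`
      ((fun t : ℝ => K t - (1 / (4 * t) + (5 / 6 - 2 * m + 2 * m ^ 2)
          + t * (19 / 15 - 6 * m + 14 * m ^ 2 - 16 * m ^ 3 + 8 * m ^ 4)))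
        =O[𝓝[>] 0] fun t : ℝ => t ^ 2) ∧
      -- consistency with the general formulas for the heat kernel coefficients
      (1 / 4 = (4 * Real.pi)⁻¹ * SymplecticSpinor.fsArea.real Set.univ) ∧
      (5 / 6 - 2 * m + 2 * m ^ 2 =
        (4 * Real.pi)⁻¹ * (1 / 6) * (1 + 6 * SymplecticSpinor.charge l ^ 2) *
          ∫ ζ, SymplecticSpinor.fsScalarCurvature ζ ∂SymplecticSpinor.fsArea) ∧
      (19 / 15 - 6 * m + 14 * m ^ 2 - 16 * m ^ 3 + 8 * m ^ 4 =
        (4 * Real.pi)⁻¹ * (1 / 120) *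
          (2 + 15 * SymplecticSpinor.charge l ^ 2 + 60 * SymplecticSpinor.charge l ^ 4) *
          ∫ ζ, SymplecticSpinor.fsScalarCurvature ζ ^ 2 ∂SymplecticSpinor.fsArea) := by
  have hpi : Real.pi ≠ 0 := Real.pi_ne_zero
  refine ⟨SymplecticSpinor.restrictedLaplacian l,
    SymplecticSpinor.isRestriction_restrictedLaplacian l,
    SymplecticSpinor.hasEigenvalue_restrictedLaplacian_iff l,
    SymplecticSpinor.finrank_eigenspace_restrictedLaplacian l,
    SymplecticSpinor.exists_isHeatSemigroup_restrictedLaplacian l,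
    SymplecticSpinor.heatTrace l,
    fun S hS t ht => SymplecticSpinor.hasTrace_heatSemigroup hS ht.le
      (SymplecticSpinor.hasSum_heatTrace l ht),
    fun t ht => SymplecticSpinor.hasSum_heatTrace l ht,
    SymplecticSpinor.heatTrace_expansion l m hm, ?_, ?_, ?_⟩
  · rw [SymplecticSpinor.fsArea_real_univ]
    field_simp
  · rw [SymplecticSpinor.integral_fsScalarCurvature, SymplecticSpinor.charge, hm]
    field_simp
    ring
  · rw [SymplecticSpinor.integral_fsScalarCurvature_sq, SymplecticSpinor.charge, hm]
    field_simp
    ring
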